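/- Setting. A star graph has a hub vertex $0$ joined to outer vertices $1,\dots,N$ ($N\ge 2$), and a finite graph $G$ is attached at vertex $1$. A walker has one orthonormal basis state for each directed edge, where $|j,k\rangle$ means being on the edge $jk$ and moving from $j$ to $k$. One step $U$ is given as follows. At the hub, $|j,0\rangle\mapsto -r|0,j\rangle+t\sum_{k\ne j}|0,k\rangle$ with $t=2/N$ and $r=1-t$. At the outer vertices $j=2,\dots,N$, $|0,j\rangle\mapsto e^{i\phi}|j,0\rangle$ with $\phi\in\mathbb R$. At each vertex of $G$ (including vertex $1$), an arbitrary unitary maps the states entering the vertex to the states leaving it. Put $\epsilon=1/N$, $|in\rangle=\frac1{\sqrt{N-1}}\sum_{j\ge2}|j,0\rangle$ and $|out\rangle=\frac1{\sqrt{N-1}}\sum_{j\ge2}|0,j\rangle$. On the span of $|in\rangle,|out\rangle,|0,1\rangle,|1,0\rangle$ and the directed-edge states of $G$, which is invariant under $U$, the step is the operator $U(\epsilon)$ with $$U(\epsilon)|in\rangle=(1-2\epsilon)|out\rangle+2\sqrt{\epsilon-\epsilon^2}\,|0,1\rangle,\quad U(\epsilon)|1,0\rangle=-(1-2\epsilon)|0,1\rangle+2\sqrt{\epsilon-\epsilon^2}\,|out\rangle,\quad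 U(\epsilon)|out\rangle=e^{i\phi}|in\rangle,$$ and $|0,1\rangle$ and the states of $G$ are mapped by the unitaries of $G$. These formulas define $U(\epsilon)$ for all real $\epsilon\in[0,1/2]$. Let $C(\lambda,\epsilon)$ be the characteristic polynomial of $U(\epsilon)$ and $C_0(\lambda)=C(\lambda,0)$. Theorem 2 (the three-case theorem). Let $\lambda_0$ be a root of $C_0$ of multiplicity $s\ge1$. A $\lambda_0$-family is a list of $s$ continuous functions $\lambda_1,\dots,\lambda_s$ on some interval $[0,\delta)$, $0<\delta\le 1/2$, with $\lambda_k(0)=\lambda_0$ for all $k$, such that for every $\epsilon\in[0,\delta)$ the numbers $\lambda_1(\epsilon),\dots,\lambda_s(\epsilon)$ are roots of $C(\cdot,\epsilon)$, counted with multiplicity. A $\lambda_0$-family exists, and for every $\lambda_0$-family exactly one of the following cases holds (asymptotics as $\epsilon\to0^+$): (i) $\lambda_k(\epsilon)=\lambda_0$ for all $k$ and all sufficiently small $\epsilon\ge0$; (ii) $\lambda_k(\epsilon)=\lambda_0$ for all sufficiently small $\epsilon\ge 0$ and all but one value of $k$, and the remaining root is $\lambda_0e^{ib\epsilon}+O(\epsilon^2)$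 for some real $b\neq0$; (iii) $\lambda_k(\epsilon)=\lambda_0$ for all sufficiently small $\epsilon\ge 0$ and all but two values of $k$, and the remaining two roots are paired, i.e. $\lambda_\pm(\epsilon)=\sum_{j\ge0}A_j(\pm\sqrt\epsilon)^j$ for small $\epsilon\ge 0$ with one convergent power series, and $\lambda_\pm(\epsilon)=\lambda_0e^{\pm ic\sqrt\epsilon}+O(\epsilon)$ for some real $c\neq0$. Moreover, $\lambda_0$ is a root of $C(\cdot,\epsilon)$ of multiplicity at least $s$, $s-1$, $s-2$ in the cases (i), (ii), (iii) respectively, for every $\epsilon\in[0,1/2]$. -/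

import Mathlib

open Filter Topology

noncomputable section

namespace StarWalk

/-- A graph with edge set described by its directed edges (loops and multiple edges are allowed).
`E` is the type of directed edges, `rev` reverses the direction, and `root` is the vertex that is
joined to the hub of the star (the outer vertex `1` of the star). The directed edge `e` carries the
walker state "on the edge, going from `src e` to `tgt e`". -/
structure RootedGraph (V E : Type*) where
  src : E → V
  tgt : E → V
  rev : E → E
  rev_rev : ∀ e, rev (rev e) = e
  src_rev : ∀ e, src (rev e) = tgt e
  root : V

namespace RootedGraph

variable {V E : Type*} (G : RootedGraph V E)

/-- States entering vertices of `G`: `none` is `|0,1⟩`, `some e` is the directed edge `e`.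
`entersAt` is the vertex which the state enters. -/
def entersAt : Option E → V
  | none => G.root
  | some e => G.tgt e

/-- States leaving vertices of `G`: `none` is `|1,0⟩`, `some e` is the directed edge `e`.
`leavesFrom` is the vertex which the state leaves. -/
def leavesFrom : Option E → V
  | none => G.root
  | some e => G.src e

/-- Local unitaries of the vertices of `G`: each vertex `v` maps the states entering `v` unitarily
to the states leaving `v`. -/
structure Scattering [Fintype E] [DecidableEq E] [DecidableEq V] where
  loc : ∀ v : V, Matrix {y : Option E // G.leavesFrom y = v} {x : Option E // G.entersAt x = v} ℂ
  conjTranspose_mul_self : ∀ v, (loc v).conjTranspose * loc v = 1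
  mul_conjTranspose_self : ∀ v, loc v * (loc v).conjTranspose = 1

end RootedGraph

variable {V E : Type*} [Fintype E] [DecidableEq E] [DecidableEq V] {G : RootedGraph V E}

/-- The amplitude for the state `x` entering a vertex of `G` to become the state `y`. -/
def RootedGraph.Scattering.amp (S : G.Scattering) (y x : Option E) : ℂ :=
  if h : G.leavesFrom y = G.entersAt x then S.loc (G.entersAt x) ⟨y, h⟩ ⟨x, rfl⟩ else 0

/-! ### The walk on the star with `N` edges -/

/-- Basis states of the star with `N` edges whose edge number `0 : Fin N` carries `G`:
`outward j` is `|0,j⟩` (from the hub to the outer vertex `j`), `inward j` is `|j,0⟩`. -/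
inductive StarState (N : ℕ) (E : Type*)
  | outward (j : Fin N)
  | inward (j : Fin N)
  | edge (e : E)
  deriving DecidableEq, Fintype

open StarState in
/-- One step of the scattering walk on the star with `N` edges, as a matrix
(entry `y x` is the amplitude of `y` in the image of `x`): the hub acts by
`|j,0⟩ ↦ -r |0,j⟩ + t ∑_{k ≠ j} |0,k⟩` with `t = 2 / N`, `r = 1 - t`, the outer vertices without
`G` reflect with phase `exp (i φ)`, the vertices of `G` act by their local unitaries. -/
def starWalk (S : G.Scattering) (φ : ℝ) (N : ℕ) [NeZero N] :
    Matrix (StarState N E) (StarState N E) ℂ :=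
  Matrix.of fun y x => match x, y with
    | inward j, outward k => if k = j then -(1 - 2 / (N : ℂ)) else 2 / (N : ℂ)
    | outward j, inward k =>
        if j = 0 then (if k = 0 then S.amp none none else 0)
        else (if k = j then Complex.exp (Complex.I * φ) else 0)
    | outward j, edge e => if j = 0 then S.amp (some e) none else 0
    | edge e, inward k => if k = 0 then S.amp none (some e) else 0
    | edge e, edge f => S.amp (some f) (some e)
    | _, _ => 0

/-! ### The walk on the symmetric subspace, `ε = 1 / N` -/

/-- Orthonormal basis of the subspace in which the walk takes place: `ketIn` and `ketOut` are the
uniform superpositions of the states `|j,0⟩` and `|0,j⟩` over the `N - 1` edges without `G`,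
`toG` is `|0,1⟩`, `fromG` is `|1,0⟩`, `edge e` are the directed edges of `G`. -/
inductive State (E : Type*)
  | ketIn
  | ketOut
  | toG
  | fromG
  | edge (e : E)
  deriving DecidableEq, Fintype

open State in
/-- The walk operator `U(ε)` (entry `y x` is the amplitude of `y` in the image of `x`). -/
def walk (S : G.Scattering) (φ ε : ℝ) : Matrix (State E) (State E) ℂ :=
  Matrix.of fun y x => match x, y with
    | ketOut, ketIn => Complex.exp (Complex.I * φ)
    | ketIn, ketOut => ((1 - 2 * ε : ℝ) : ℂ)
    | ketIn, toG => ((2 * √(ε - ε ^ 2) : ℝ) : ℂ)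
    | fromG, toG => ((-(1 - 2 * ε) : ℝ) : ℂ)
    | fromG, ketOut => ((2 * √(ε - ε ^ 2) : ℝ) : ℂ)
    | toG, fromG => S.amp none none
    | toG, edge e => S.amp (some e) none
    | edge e, fromG => S.amp none (some e)
    | edge e, edge f => S.amp (some f) (some e)
    | _, _ => 0

open State in
/-- The inclusion of the symmetric subspace into the state space of the star with `N` edges. -/
def inclusion (E : Type*) [DecidableEq E] (N : ℕ) [NeZero N] :
    Matrix (StarState N E) (State E) ℂ :=
  Matrix.of fun y x => match x, y with
    | ketIn, .inward j => if j = 0 then 0 else ((1 / √(N - 1 : ℝ) : ℝ) : ℂ)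
    | ketOut, .outward j => if j = 0 then 0 else ((1 / √(N - 1 : ℝ) : ℝ) : ℂ)
    | toG, .outward j => if j = 0 then 1 else 0
    | fromG, .inward j => if j = 0 then 1 else 0
    | edge e, .edge f => if f = e then 1 else 0
    | _, _ => 0


/-- On the symmetric subspace, one step of the walk on the star with `N` edges is `U(1 / N)`. -/
theorem starWalk_mul_inclusion (S : G.Scattering) (φ : ℝ) (N : ℕ) [NeZero N] (hN : 2 ≤ N) :
    starWalk S φ N * inclusion E N = inclusion E N * walk S φ (1 / N) := by
  have hN' : (2 : ℝ) ≤ N := by exact_mod_cast hN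
  have h0 : (0 : ℝ) < N := by linarith
  have hs : (0 : ℝ) < √(N - 1 : ℝ) := Real.sqrt_pos.2 (by linarith)
  have hsq : √(N - 1 : ℝ) * √(N - 1 : ℝ) = N - 1 := Real.mul_self_sqrt (by linarith)
  have hy : √(1 / (N : ℝ) - (1 / N) ^ 2) = √(N - 1 : ℝ) / N := by
    rw [Real.sqrt_eq_iff_mul_self_eq_of_pos (by positivity)]
    field_simp
    rw [pow_two, hsq]
  have key : ∀ (k : Fin N) (a b c : ℂ),
      (∑ j : Fin N, (if k = j then a else b) * (if j = 0 then 0 else c))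
        = if k = 0 then (N - 1) * (b * c) else a * c + (N - 2) * (b * c) := by
    intro k a b c
    have h1 : ∀ j : Fin N, (if k = j then a else b) * (if j = 0 then 0 else c)
        = b * c + (if k = j then (a - b) * c else 0) - (if j = 0 then b * c else 0)
          - (if k = j then (if k = 0 then (a - b) * c else 0) else 0) := by
      intro j
      by_cases h : k = j
      · subst h
        by_cases h' : k = 0 <;> simp [h'] <;> ring
      · by_cases h' : j = 0
        · subst h'
          simp [h]
        · simp [h, h']
    simp only [h1, Finset.sum_add_distrib, Finset.sum_sub_distrib, Finset.sum_ite_eq,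
      Finset.sum_ite_eq', Finset.mem_univ, if_true, Finset.sum_const, Finset.card_univ,
      Fintype.card_fin, nsmul_eq_mul]
    split_ifs <;> ring
  have hsumS : ∀ f : StarState N E → ℂ, ∑ x, f x =
      (∑ j, f (.outward j)) + (∑ j, f (.inward j)) + ∑ e, f (.edge e) := by
    intro f
    let e : StarState N E ≃ (Fin N ⊕ Fin N) ⊕ E :=
      { toFun := fun x => match x with
          | .outward j => .inl (.inl j)
          | .inward j => .inl (.inr j)
          | .edge e => .inr e
        invFun := fun x => match x with
          | .inl (.inl j) => .outward j
          | .inl (.inr j) => .inward j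
          | .inr e => .edge e
        left_inv := by rintro (_ | _ | _) <;> rfl
        right_inv := by rintro ((_ | _) | _) <;> rfl }
    rw [← Equiv.sum_comp e.symm, Fintype.sum_sum_type, Fintype.sum_sum_type]
    rfl
  have hsum : ∀ f : State E → ℂ, ∑ x, f x =
      f .ketIn + f .ketOut + f .toG + f .fromG + ∑ e, f (.edge e) := by
    intro f
    let e : State E ≃ Fin 4 ⊕ E :=
      { toFun := fun x => match x with
          | .ketIn => .inl 0
          | .ketOut => .inl 1
          | .toG => .inl 2
          | .fromG => .inl 3
          | .edge e => .inr e
        invFun := fun x => match x with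
          | .inl 0 => .ketIn
          | .inl 1 => .ketOut
          | .inl 2 => .toG
          | .inl 3 => .fromG
          | .inr e => .edge e
        left_inv := by rintro (_ | _ | _ | _ | _) <;> rfl
        right_inv := by
          rintro (j | _)
          · fin_cases j <;> rfl
          · rfl }
    rw [← Equiv.sum_comp e.symm, Fintype.sum_sum_type, Fin.sum_univ_four]
    rfl
  ext y x
  rw [Matrix.mul_apply, Matrix.mul_apply, hsumS, hsum]
  have hNc : (N : ℂ) ≠ 0 := by exact_mod_cast h0.ne'
  have hsc : ((√(N - 1 : ℝ) : ℝ) : ℂ) ≠ 0 := by exact_mod_cast hs.ne'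
  have hsqc : ((√(N - 1 : ℝ) : ℝ) : ℂ) ^ 2 = N - 1 := by
    rw [pow_two]
    exact_mod_cast hsq
  rcases x with _ | _ | _ | _ | e <;> rcases y with k | k | f
  case ketIn.outward =>
    simp only [starWalk, inclusion, walk, Matrix.of_apply, mul_zero,
      Finset.sum_const_zero, zero_add, add_zero, key, hy]
    by_cases hk : k = 0
    · simp only [hk, if_true]
      push_cast
      field_simp
      linear_combination -2 * hsqc
    · simp only [hk, if_false]
      push_cast
      field_simp
      ring
  case ketOut.inward =>
    simp only [starWalk, inclusion, walk, Matrix.of_apply, mul_zero, zero_mul,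
      Finset.sum_const_zero, zero_add, add_zero]
    rw [Finset.sum_eq_single k]
    · by_cases hk : k = 0 <;> simp [hk, mul_comm]
    · intro j _ hj
      by_cases h' : j = 0 <;> simp [h', hj.symm]
    · simp
  case ketOut.edge =>
    simp only [starWalk, inclusion, walk, Matrix.of_apply, mul_zero, zero_mul,
      Finset.sum_const_zero, zero_add, add_zero]
    exact Finset.sum_eq_zero fun j _ => by by_cases h' : j = 0 <;> simp [h']
  case fromG.outward =>
    simp only [starWalk, inclusion, walk, Matrix.of_apply, mul_zero, zero_mul,
      Finset.sum_const_zero, zero_add, add_zero, hy]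
    rw [Finset.sum_eq_single 0]
    · by_cases hk : k = 0
      · simp [hk, div_eq_mul_inv]
      · simp only [hk, if_false, if_true]
        push_cast
        field_simp
        ring
    · intro j _ hj
      simp [hj]
    · simp
  all_goals simp [starWalk, inclusion, walk]

/-- The characteristic polynomial `C(·, ε)` of `U(ε)`; `C(·, 0)` is that of `U₀ = U(0)`. -/
def charPoly (S : G.Scattering) (φ ε : ℝ) : Polynomial ℂ := (walk S φ ε).charpoly

/-! ### Families of roots -/

/-- `Λ 0, …, Λ (s - 1)` are the roots of the `lam0`-family on `[0, δ)`: continuous, starting at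
`lam0`, and at each `ε` roots of `C(·, ε)` counted with multiplicity. -/
structure IsRootFamily (S : G.Scattering) (φ : ℝ) (lam0 : ℂ) (s : ℕ) (δ : ℝ)
    (Λ : Fin s → ℝ → ℂ) : Prop where
  pos : 0 < δ
  le_half : δ ≤ 1 / 2
  zero : ∀ k, Λ k 0 = lam0
  continuousOn : ∀ k, ContinuousOn (Λ k) (Set.Ico 0 δ)
  roots : ∀ ε ∈ Set.Ico 0 δ,
    (Finset.univ.val.map fun k => Λ k ε) ≤ (charPoly S φ ε).roots

/-- The function is constantly `lam0` on some interval `[0, η)`. -/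
def IsConst (lam0 : ℂ) (f : ℝ → ℂ) : Prop := ∀ᶠ ε in 𝓝[≥] (0 : ℝ), f ε = lam0

/-- For all `ε ∈ [0, 1/2]`, `lam0` is a root of `C(·, ε)` of multiplicity at least `m`. -/
def HasConstRoots (S : G.Scattering) (φ : ℝ) (lam0 : ℂ) (m : ℕ) : Prop :=
  ∀ ε ∈ Set.Icc (0 : ℝ) (1 / 2), m ≤ (charPoly S φ ε).rootMultiplicity lam0

/-- Paired roots: the two values `∑ j, A j * (± √ε) ^ j` of one convergent series. -/
def IsPaired (f g : ℝ → ℂ) : Prop :=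
  ∃ h : ℂ → ℂ, AnalyticAt ℂ h 0 ∧
    ∀ᶠ ε in 𝓝[≥] (0 : ℝ), f ε = h (√ε : ℝ) ∧ g ε = h (-(√ε : ℝ))

/-- All roots of the family are constant. -/
def CaseOne (S : G.Scattering) (φ : ℝ) (lam0 : ℂ) {s : ℕ} (Λ : Fin s → ℝ → ℂ) : Prop :=
  (∀ k, IsConst lam0 (Λ k)) ∧ HasConstRoots S φ lam0 s

/-- All roots of the family but one are constant, and that one is
`lam0 * exp (i b ε) + O(ε²)` with `b ≠ 0` real. -/
def CaseTwo (S : G.Scattering) (φ : ℝ) (lam0 : ℂ) {s : ℕ} (Λ : Fin s → ℝ → ℂ) : Prop :=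
  ∃ p : Fin s, (∀ k, k ≠ p → IsConst lam0 (Λ k)) ∧ HasConstRoots S φ lam0 (s - 1) ∧
    ∃ b : ℝ, b ≠ 0 ∧
      (fun ε : ℝ => Λ p ε - lam0 * Complex.exp (Complex.I * b * ε))
        =O[𝓝[≥] (0 : ℝ)] fun ε : ℝ => ε ^ 2

/-- All roots of the family but two are constant, and those two are paired and equal to
`lam0 * exp (± i c √ε) + O(ε)` with `c ≠ 0` real. -/
def CaseThree (S : G.Scattering) (φ : ℝ) (lam0 : ℂ) {s : ℕ} (Λ : Fin s → ℝ → ℂ) : Prop :=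
  ∃ p q : Fin s, p ≠ q ∧ (∀ k, k ≠ p → k ≠ q → IsConst lam0 (Λ k)) ∧
    HasConstRoots S φ lam0 (s - 2) ∧ IsPaired (Λ p) (Λ q) ∧
    ∃ c : ℝ, c ≠ 0 ∧
      ((fun ε : ℝ => Λ p ε - lam0 * Complex.exp (Complex.I * c * (√ε : ℝ)))
        =O[𝓝[≥] (0 : ℝ)] fun ε : ℝ => ε) ∧
      ((fun ε : ℝ => Λ q ε - lam0 * Complex.exp (-(Complex.I * c * (√ε : ℝ))))
        =O[𝓝[≥] (0 : ℝ)] fun ε : ℝ => ε)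

end StarWalk

end

open Filter Topology

noncomputable section

namespace StarWalk

variable {V E : Type*} [Fintype E] [DecidableEq E] [DecidableEq V] {G : RootedGraph V E}

/-! The step `U(ε)` is unitary for `ε ∈ [0, 1/2]`, so all roots lie on the unit circle. Despite the
square root in the hub amplitudes, the characteristic polynomial is affine in `ε`: `C(λ, ε) = C₀(λ)
+ ε Q(λ)` (`exists_charPoly_eq`). Taking out the largest common power `(λ - λ₀)^m` leaves `(λ -
λ₀)^d c + ε f` with `m + d = s`, `c(λ₀) ≠ 0`, and `f(λ₀) ≠ 0` unless `d = 0` (`exists_isReduction`).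
The common power accounts for the constant roots.

If `d = 0`, the remaining factor has no root near `λ₀` for small `ε`. If `d > 0`, its root equation
is `ψ(λ - λ₀)^d = ε` with `ψ` locally biholomorphic, so its roots are `λ₀ + Φ(ζ ε^(1/d))` with `Φ =
ψ⁻¹`, one for each `d`-th root of unity `ζ` (`exists_isRootBranch`). They stay on the unit circle,
so every direction `Φ'(0) ζ` is tangent to it at `λ₀`; `d` equally spaced directions lie on one line
only if `d ≤ 2` (`IsReduction.le_two`). Thus `d = 0, 1, 2` are the three cases, and tangency makes
the constants `b` and `c` of the theorem real.

Every continuous family has this form: each member keeps one label `ζ` or `0`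
(`IsRootFamily.exists_label`), and counting multiplicities shows that every `ζ` occurs exactly once.
-/

/-! ### Unitarity of the step and unimodularity of its eigenvalues -/

omit [DecidableEq E] in
theorem State.sum_eq {M : Type*} [AddCommMonoid M] (f : State E → M) : ∑ x, f x =
    f .ketIn + f .ketOut + f .toG + f .fromG + ∑ e, f (.edge e) := by
  let e : State E ≃ Fin 4 ⊕ E :=
    { toFun := fun x => match x with
        | .ketIn => .inl 0
        | .ketOut => .inl 1
        | .toG => .inl 2
        | .fromG => .inl 3
        | .edge e => .inr e
      invFun := fun x => match x with
        | .inl 0 => .ketIn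
        | .inl 1 => .ketOut
        | .inl 2 => .toG
        | .inl 3 => .fromG
        | .inr e => .edge e
      left_inv := by rintro (_ | _ | _ | _ | _) <;> rfl
      right_inv := by
        rintro (j | _)
        · fin_cases j <;> rfl
        · rfl }
  rw [← Equiv.sum_comp e.symm, Fintype.sum_sum_type, Fin.sum_univ_four]
  rfl

/-- The global amplitude matrix is block diagonal over the vertices: columns entering one vertex are
orthonormal by its local unitary, and columns entering different vertices have disjoint supports. -/
theorem RootedGraph.Scattering.sum_star_amp_mul_amp (S : G.Scattering) (x x' : Option E) :
    ∑ y, star (S.amp y x) * S.amp y x' = if x = x' then 1 else 0 := by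
  by_cases hv : G.entersAt x = G.entersAt x'
  · have key : ∀ v (hx : G.entersAt x = v) (hx' : G.entersAt x' = v),
        ∑ y, star (S.amp y x) * S.amp y x' = if x = x' then 1 else 0 := by
      intro v hx hx'
      have h := congrFun (congrFun (S.conjTranspose_mul_self v) ⟨x, hx⟩) ⟨x', hx'⟩
      rw [Matrix.mul_apply, Matrix.one_apply] at h
      simp only [Subtype.mk.injEq, Matrix.conjTranspose_apply] at h
      rw [← h]
      rw [← Finset.sum_filter_of_ne (p := fun y => G.leavesFrom y = v), Finset.sum_subtype _
        (p := fun y => G.leavesFrom y = v) (by simp)]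
      · subst hx
        refine Finset.sum_congr rfl fun y _ => ?_
        rw [RootedGraph.Scattering.amp, dif_pos y.2, RootedGraph.Scattering.amp,
          dif_pos (y.2.trans hx'.symm)]
        congr 1
        -- `amp` reads the block indexed by `G.entersAt x'`, while `h` lives in the block of `x`;
        -- the two indices are equal only propositionally.
        have : ∀ v (hx' : G.entersAt x' = v) (hy : G.leavesFrom y = v),
            S.loc v ⟨y, hy⟩ ⟨x', hx'⟩ =
              S.loc (G.entersAt x') ⟨y, hy.trans hx'.symm⟩ ⟨x', rfl⟩ := by
          rintro _ rfl _
          rfl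
        exact (this _ hx' y.2).symm
      · intro y _ hy
        by_contra hne
        refine hy ?_
        rw [RootedGraph.Scattering.amp, dif_neg (hx ▸ hne), star_zero, zero_mul]
    exact key _ rfl hv.symm
  · rw [if_neg (by rintro rfl; exact hv rfl)]
    refine Finset.sum_eq_zero fun y _ => ?_
    unfold RootedGraph.Scattering.amp
    by_cases h1 : G.leavesFrom y = G.entersAt x
    · rw [dif_neg (h1.trans_ne hv), mul_zero]
    · rw [dif_neg h1, star_zero, zero_mul]

open State in
/-- The walk with general hub amplitudes `h`, `k` and reflection phase `w`. -/
def hubWalk (S : G.Scattering) (w h k : ℂ) : Matrix (State E) (State E) ℂ :=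
  Matrix.of fun y x => match x, y with
    | ketOut, ketIn => w
    | ketIn, ketOut => h
    | ketIn, toG => k
    | fromG, toG => -h
    | fromG, ketOut => k
    | toG, fromG => S.amp none none
    | toG, edge e => S.amp (some e) none
    | edge e, fromG => S.amp none (some e)
    | edge e, edge f => S.amp (some f) (some e)
    | _, _ => 0

theorem walk_eq_hubWalk (S : G.Scattering) (φ ε : ℝ) :
    walk S φ ε = hubWalk S (Complex.exp (Complex.I * φ)) ((1 - 2 * ε : ℝ) : ℂ)
      ((2 * √(ε - ε ^ 2) : ℝ) : ℂ) := by
  ext y x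
  rcases x with _ | _ | _ | _ | e <;> rcases y with _ | _ | _ | _ | f <;>
    simp [walk, hubWalk]

theorem conjTranspose_mul_hubWalk (S : G.Scattering) {w : ℂ} (hw : star w * w = 1) {h k : ℝ}
    (hk : h ^ 2 + k ^ 2 = 1) :
    (hubWalk S w h k).conjTranspose * hubWalk S w h k = 1 := by
  have hk' : (h : ℂ) * h + k * k = 1 := by
    rw [← sq, ← sq]; exact_mod_cast hk
  have hS := S.sum_star_amp_mul_amp
  simp only [Fintype.sum_option] at hS
  ext x x'
  rw [Matrix.mul_apply, State.sum_eq]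
  simp only [Matrix.conjTranspose_apply]
  rcases x with _ | _ | _ | _ | e <;> rcases x' with _ | _ | _ | _ | f
  all_goals simp [hubWalk, Matrix.one_apply]
  all_goals first
    | done
    | exact hw
    | linear_combination hk'
    | ring1
    | simpa using hS none none
    | simpa using hS none (some f)
    | simpa using hS (some e) none
    | simpa using hS (some e) (some f)

theorem hub_amplitudes_sq {ε : ℝ} (hε : ε ∈ Set.Icc (0 : ℝ) (1 / 2)) :
    (1 - 2 * ε) ^ 2 + (2 * √(ε - ε ^ 2)) ^ 2 = 1 := by
  rw [mul_pow, Real.sq_sqrt (by nlinarith [hε.1, hε.2])]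
  ring

/-- The eigenvalues of an isometric matrix are unimodular. -/
theorem norm_eq_one_of_isRoot_charpoly {n : Type*} [Fintype n] [DecidableEq n]
    {U : Matrix n n ℂ} (hU : U.conjTranspose * U = 1) {μ : ℂ} (hμ : U.charpoly.IsRoot μ) :
    ‖μ‖ = 1 := by
  rw [Polynomial.IsRoot.def, Matrix.eval_charpoly] at hμ
  obtain ⟨v, hv, hv'⟩ := Matrix.exists_mulVec_eq_zero_iff.2 hμ
  have hUv : U.mulVec v = μ • v := by
    rw [Matrix.sub_mulVec, sub_eq_zero] at hv'
    rw [← hv']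
    ext i
    simp [Matrix.scalar_apply, Matrix.mulVec_diagonal]
  have h1 : star (U.mulVec v) ⬝ᵥ U.mulVec v = star v ⬝ᵥ v := by
    rw [Matrix.star_mulVec, ← Matrix.dotProduct_mulVec, Matrix.mulVec_mulVec, hU,
      Matrix.one_mulVec]
  rw [hUv, star_smul, smul_dotProduct, dotProduct_smul, smul_smul, smul_eq_mul] at h1
  have h2 : star v ⬝ᵥ v ≠ 0 := by
    open ComplexOrder in exact fun h => hv (dotProduct_star_self_eq_zero.1 h)
  have h3 := mul_eq_right₀ h2 |>.1 h1
  have h4 : (‖μ‖ ^ 2 : ℝ) = 1 := by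
    have : (starRingEnd ℂ) μ * μ = 1 := h3
    rw [Complex.conj_mul'] at this
    exact_mod_cast this
  nlinarith [norm_nonneg μ]

theorem norm_eq_one_of_isRoot_charPoly (S : G.Scattering) (φ : ℝ) {ε : ℝ}
    (hε : ε ∈ Set.Icc (0 : ℝ) (1 / 2)) {μ : ℂ} (hμ : (charPoly S φ ε).IsRoot μ) : ‖μ‖ = 1 := by
  refine norm_eq_one_of_isRoot_charpoly ?_ hμ
  rw [walk_eq_hubWalk]
  refine conjTranspose_mul_hubWalk S ?_ (hub_amplitudes_sq hε)
  have := Complex.norm_exp_I_mul_ofReal φ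
  have h2 := Complex.conj_mul' (Complex.exp (Complex.I * φ))
  rw [this] at h2
  simpa using h2

/-! ### Affine dependence of the characteristic polynomial on `ε` -/

/-- `k` is the only amplitude between the span of `ketIn`, `ketOut` and the rest, so conjugation by
the sign that is `-1` on this span reverses `k`. -/
theorem charpoly_hubWalk_neg (S : G.Scattering) (w h k : ℂ) :
    (hubWalk S w h (-k)).charpoly = (hubWalk S w h k).charpoly := by
  let p : State E → ℂ := fun x => match x with
    | .ketIn => -1
    | .ketOut => -1
    | _ => 1
  have h1 : hubWalk S w h (-k) = Matrix.diagonal p * (hubWalk S w h k * Matrix.diagonal p) := by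
    ext y x
    rw [Matrix.diagonal_mul, Matrix.mul_diagonal]
    rcases x with _ | _ | _ | _ | e <;> rcases y with _ | _ | _ | _ | f <;> simp [hubWalk, p]
  have h2 : Matrix.diagonal p * Matrix.diagonal p = 1 := by
    rw [Matrix.diagonal_mul_diagonal, ← Matrix.diagonal_one]
    congr 1
    ext x
    rcases x with _ | _ | _ | _ | e <;> simp [p]
  rw [h1, Matrix.charpoly_mul_comm, Matrix.mul_assoc, h2, Matrix.mul_one]

section TwoColumns

variable {n R : Type*} [Fintype n] [DecidableEq n] [CommRing R]

/-- The determinant after replacing the columns `i` and `j`. -/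
def detTwoCol (M : Matrix n n R) (i j : n) (u v : n → R) : R :=
  ((M.updateCol i u).updateCol j v).det

variable {M : Matrix n n R} {i j : n}

theorem detTwoCol_add_right (u v v' : n → R) :
    detTwoCol M i j u (v + v') = detTwoCol M i j u v + detTwoCol M i j u v' :=
  Matrix.det_updateCol_add _ _ _ _

theorem detTwoCol_smul_right (a : R) (u v : n → R) :
    detTwoCol M i j u (a • v) = a * detTwoCol M i j u v :=
  Matrix.det_updateCol_smul _ _ _ _

theorem detTwoCol_comm (hij : i ≠ j) (u v : n → R) :
    detTwoCol M i j u v = detTwoCol M j i v u := by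
  unfold detTwoCol
  rw [Matrix.updateCol_comm _ hij]

theorem detTwoCol_add_left (hij : i ≠ j) (u u' v : n → R) :
    detTwoCol M i j (u + u') v = detTwoCol M i j u v + detTwoCol M i j u' v := by
  simp only [detTwoCol_comm hij, detTwoCol_add_right]

theorem detTwoCol_smul_left (hij : i ≠ j) (a : R) (u v : n → R) :
    detTwoCol M i j (a • u) v = a * detTwoCol M i j u v := by
  simp only [detTwoCol_comm hij, detTwoCol_smul_right]

theorem detTwoCol_self (hij : i ≠ j) (u : n → R) : detTwoCol M i j u u = 0 :=
  Matrix.det_zero_of_column_eq hij fun k => by simp [hij]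

theorem detTwoCol_swap (hij : i ≠ j) (u v : n → R) :
    detTwoCol M i j u v = - detTwoCol M i j v u := by
  have h := detTwoCol_self (M := M) hij (u + v)
  rw [detTwoCol_add_left hij, detTwoCol_add_right, detTwoCol_add_right, detTwoCol_self hij,
    detTwoCol_self hij] at h
  linear_combination h

end TwoColumns

open Polynomial in
-- Only the columns `ketIn` and `fromG` contain `h` or `k`, and the determinant is bilinear in them.
-- The `h * k` terms vanish by alternation, `h ^ 2` and `k ^ 2` share one coefficient and add up to
-- a constant, and the term linear in `k` vanishes because the characteristic polynomial is even in
-- `k`.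
theorem exists_charpoly_hubWalk_eq (S : G.Scattering) (w : ℂ) :
    ∃ A B : ℂ[X], ∀ h k : ℂ, h ^ 2 + k ^ 2 = 1 →
      (hubWalk S w h k).charpoly = A + C h * B := by
  let M := (hubWalk S w 0 0).charmatrix
  let b : State E → State E → ℂ[X] := fun x => Pi.single x 1
  let D := detTwoCol M .ketIn .fromG
  have hne : (State.ketIn : State E) ≠ State.fromG := by simp
  have expand : ∀ h k : ℂ, h ^ 2 + k ^ 2 = 1 → (hubWalk S w h k).charpoly =
      (X ^ 2 * D (b .ketIn) (b .fromG) - D (b .ketOut) (b .toG)) +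
      C h * (X * (D (b .ketIn) (b .toG) - D (b .ketOut) (b .fromG))) +
      C k * (-(X * (D (b .ketIn) (b .ketOut) + D (b .toG) (b .fromG)))) := by
    intro h k hk
    have hcols : (hubWalk S w h k).charmatrix = (M.updateCol .ketIn
        ((X : ℂ[X]) • b .ketIn + (-C h) • b .ketOut + (-C k) • b .toG)).updateCol .fromG
        ((X : ℂ[X]) • b .fromG + C h • b .toG + (-C k) • b .ketOut) := by
      ext1 y x
      rcases x with _ | _ | _ | _ | e <;> rcases y with _ | _ | _ | _ | f <;>
        simp [M, b, Matrix.charmatrix_apply, hubWalk,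
          Matrix.diagonal_apply]
    have hC : (C h : ℂ[X]) ^ 2 + C k ^ 2 = 1 := by
      rw [← C_pow, ← C_pow, ← C_add, hk, C_1]
    have : (hubWalk S w h k).charpoly = D
        ((X : ℂ[X]) • b .ketIn + (-C h) • b .ketOut + (-C k) • b .toG)
        ((X : ℂ[X]) • b .fromG + C h • b .toG + (-C k) • b .ketOut) := by
      rw [Matrix.charpoly, hcols]
      rfl
    rw [this]
    simp only [D, detTwoCol_add_left hne, detTwoCol_add_right, detTwoCol_smul_left hne,
      detTwoCol_smul_right, detTwoCol_self hne]
    rw [detTwoCol_swap hne (b .toG) (b .ketOut)]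
    linear_combination -(detTwoCol M .ketIn .fromG (b .ketOut) (b .toG)) * hC
  refine ⟨X ^ 2 * D (b .ketIn) (b .fromG) - D (b .ketOut) (b .toG),
    X * (D (b .ketIn) (b .toG) - D (b .ketOut) (b .fromG)), fun h k hk => ?_⟩
  rw [expand h k hk]
  -- Comparing `k = 1` with `k = -1` at `h = 0` isolates twice the coefficient of `k`.
  have h1 := expand 0 1 (by simp)
  have h2 := expand 0 (-1) (by simp)
  rw [charpoly_hubWalk_neg, h1] at h2
  have h3 : -(X * (D (b .ketIn) (b .ketOut) + D (b .toG) (b .fromG))) = (0 : ℂ[X]) := by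
    simp only [C_neg, C_1] at h2
    have h4 : (2 : ℂ[X]) * -(X * (D (b .ketIn) (b .ketOut) + D (b .toG) (b .fromG))) = 0 := by
      linear_combination h2
    exact (mul_eq_zero.1 h4).resolve_left two_ne_zero
  rw [h3, mul_zero, add_zero]

open Polynomial in
/-- The characteristic polynomial depends affinely on `ε`. -/
theorem exists_charPoly_eq (S : G.Scattering) (φ : ℝ) :
    ∃ Q : ℂ[X], ∀ ε ∈ Set.Icc (0 : ℝ) (1 / 2),
      charPoly S φ ε = charPoly S φ 0 + C (ε : ℂ) * Q := by
  obtain ⟨A, B, h⟩ := exists_charpoly_hubWalk_eq S (Complex.exp (Complex.I * φ))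
  have h' : ∀ ε ∈ Set.Icc (0 : ℝ) (1 / 2), charPoly S φ ε = A + C ((1 - 2 * ε : ℝ) : ℂ) * B := by
    intro ε hε
    rw [charPoly, walk_eq_hubWalk, h]
    exact_mod_cast hub_amplitudes_sq hε
  refine ⟨-2 * B, fun ε hε => ?_⟩
  rw [h' ε hε, h' 0 ⟨le_rfl, by norm_num⟩]
  simp only [Complex.ofReal_sub, Complex.ofReal_mul, C_sub, C_mul, Complex.ofReal_one,
    Complex.ofReal_ofNat, Complex.ofReal_zero, C_0, C_1]
  have : (C (2 : ℂ) : ℂ[X]) = 2 := rfl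
  rw [this]
  ring

/-! ### Local parametrization of the moving roots -/

open Polynomial in
/-- `Φ` parametrizes the roots near `z₀` of `(X - z₀) ^ d * c + ε * f`: they are `z₀ + Φ t` with
`t ^ d = ε`, they are simple for `ε ≠ 0`, and `ψ` is the inverse of `Φ`. -/
structure IsRootBranch (c f : ℂ[X]) (z₀ : ℂ) (d : ℕ) (Φ ψ : ℂ → ℂ) (r : ℝ) : Prop where
  pos : 0 < r
  analyticAt : AnalyticAt ℂ Φ 0
  map_zero : Φ 0 = 0
  inv_zero : ψ 0 = 0
  deriv_ne_zero : deriv Φ 0 ≠ 0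
  left_inv : ∀ z, ‖z‖ < r → Φ (ψ z) = z
  right_inv : ∀ t, ‖t‖ < r → ψ (Φ t) = t
  continuousAt : ∀ t, ‖t‖ < r → ContinuousAt Φ t
  continuousAt_inv : ∀ z, ‖z‖ < r → ContinuousAt ψ z
  isRoot_iff : ∀ z, ‖z‖ < r → ∀ ε,
    ((X - C z₀) ^ d * c + C ε * f).IsRoot (z₀ + z) ↔ ψ z ^ d = ε
  isRoot_param : ∀ t, ‖t‖ < r → ((X - C z₀) ^ d * c + C (t ^ d) * f).IsRoot (z₀ + Φ t)
  simple : ∀ z, ‖z‖ < r → ∀ ε, ε ≠ 0 → ((X - C z₀) ^ d * c + C ε * f).IsRoot (z₀ + z) →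
    ¬ (derivative ((X - C z₀) ^ d * c + C ε * f)).IsRoot (z₀ + z)

theorem exists_analyticAt_localInverse {ψ : ℂ → ℂ} {a : ℂ} (hψ : AnalyticAt ℂ ψ a)
    (h' : deriv ψ a ≠ 0) :
    ∃ Φ : ℂ → ℂ, AnalyticAt ℂ Φ (ψ a) ∧ Φ (ψ a) = a ∧ HasDerivAt Φ (deriv ψ a)⁻¹ (ψ a) ∧
      (∀ᶠ z in 𝓝 a, Φ (ψ z) = z) ∧ ∀ᶠ t in 𝓝 (ψ a), ψ (Φ t) = t := by
  have hs : HasStrictDerivAt ψ (deriv ψ a) a := hψ.hasStrictDerivAt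
  have hf := hs.hasStrictFDerivAt_equiv h'
  let e := hf.toOpenPartialHomeomorph ψ
  have ha : a ∈ e.source := hf.mem_toOpenPartialHomeomorph_source
  refine ⟨e.symm, ?_, e.left_inv ha, ?_, e.eventually_left_inverse ha,
    e.eventually_right_inverse (e.map_source ha)⟩
  · exact e.analyticAt_symm' ha hψ hf.hasFDerivAt.fderiv
  · exact (hs.to_localInverse h').hasDerivAt

/-- Dividing by `q a` moves the value at `a` to `1`, where the principal logarithm is analytic; `b`
is a `d`-th root of `q a`. -/
theorem exists_analyticAt_root {q : ℂ → ℂ} {a : ℂ} (hq : AnalyticAt ℂ q a) (h0 : q a ≠ 0) {d : ℕ}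
    (hd : d ≠ 0) :
    ∃ w : ℂ → ℂ, AnalyticAt ℂ w a ∧ w a ≠ 0 ∧ ∀ᶠ z in 𝓝 a, w z ^ d = q z := by
  obtain ⟨b, hb⟩ := IsAlgClosed.exists_pow_nat_eq (q a) (Nat.pos_of_ne_zero hd)
  have hb0 : b ≠ 0 := by
    rintro rfl
    rw [zero_pow hd] at hb
    exact h0 hb.symm
  have hdc : (d : ℂ) ≠ 0 := by exact_mod_cast hd
  refine ⟨fun z => b * Complex.exp (Complex.log (q z / q a) / d), ?_, ?_, ?_⟩
  · have h1 : AnalyticAt ℂ (fun z => Complex.log (q z / q a)) a :=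
      (hq.div analyticAt_const h0).clog (by
        simp only [Pi.div_apply, div_self h0]
        exact Complex.one_mem_slitPlane)
    exact analyticAt_const.mul ((h1.div analyticAt_const hdc).cexp)
  · exact mul_ne_zero hb0 (Complex.exp_ne_zero _)
  · filter_upwards [hq.continuousAt.eventually_ne h0] with z hz
    rw [mul_pow, hb, ← Complex.exp_nat_mul, mul_div_cancel₀ _ hdc,
      Complex.exp_log (div_ne_zero hz h0), mul_div_cancel₀ _ h0]

open Polynomial in
-- With `w ^ d = -f / c` near `z₀`, the equation `z ^ d * c + ε * f = 0` becomes `(z / w) ^ d = ε`.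
-- As `w` does not vanish, `ψ = z / w` has a simple zero and hence an analytic inverse `Φ`.
theorem exists_isRootBranch {c f : ℂ[X]} {z₀ : ℂ} (hc : ¬ c.IsRoot z₀) (hf : ¬ f.IsRoot z₀) {d : ℕ}
    (hd : d ≠ 0) : ∃ Φ ψ r, IsRootBranch c f z₀ d Φ ψ r := by
  have hev : ∀ p : ℂ[X], AnalyticAt ℂ (fun z => p.eval (z₀ + z)) 0 := fun p =>
    (Differentiable.analyticAt (f := fun z => p.eval (z₀ + z))
      (p.differentiable.comp (differentiable_id.const_add z₀)) 0)
  have hc0 : c.eval (z₀ + 0) ≠ 0 := by simpa using hc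
  have hf0 : f.eval (z₀ + 0) ≠ 0 := by simpa using hf
  obtain ⟨w, hw, hw0, hwd⟩ := exists_analyticAt_root (((hev f).neg).div (hev c) hc0)
    (by simpa using ⟨hf, hc⟩) hd
  set ψ : ℂ → ℂ := fun z => z / w z
  have hψ : AnalyticAt ℂ ψ 0 := analyticAt_id.div hw hw0
  have hψ0 : ψ 0 = 0 := by simp [ψ]
  have hψ' : deriv ψ 0 ≠ 0 := by
    have : HasDerivAt ψ _ 0 := (hasDerivAt_id (0 : ℂ)).div hw.differentiableAt.hasDerivAt hw0
    rw [this.deriv]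
    simp [hw0]
  obtain ⟨Φ, hΦ, hΦ0, hΦ', hl, hr⟩ := exists_analyticAt_localInverse hψ hψ'
  rw [hψ0] at hΦ hΦ0 hΦ' hr
  set u : ℂ → ℂ := fun z => c.eval (z₀ + z) * w z ^ d
  have hu : AnalyticAt ℂ u 0 := (hev c).mul (hw.pow d)
  have hu0 : u 0 ≠ 0 := mul_ne_zero hc0 (pow_ne_zero _ hw0)
  -- The quantifier over `ε` stands inside: one neighbourhood serves every `ε`.
  have hfac : ∀ᶠ z in 𝓝 (0 : ℂ), ∀ ε : ℂ,
      ((X - C z₀) ^ d * c + C ε * f).eval (z₀ + z) = u z * (ψ z ^ d - ε) := by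
    filter_upwards [hwd, hw.continuousAt.eventually_ne hw0, (hev c).continuousAt.eventually_ne hc0]
      with z h1 h2 h3 ε
    have h1' : w z ^ d * c.eval (z₀ + z) = - f.eval (z₀ + z) := by
      rw [h1]
      simp only [Pi.div_apply, Pi.neg_apply]
      field_simp
    have h4 : w z ^ d ≠ 0 := pow_ne_zero _ h2
    simp only [eval_add, eval_mul, eval_pow, eval_sub, eval_X, eval_C, u, ψ, div_pow]
    field_simp
    linear_combination (ε : ℂ) * h1'
  have hsimple : ∀ᶠ z in 𝓝 (0 : ℂ), ∀ ε : ℂ, ε ≠ 0 →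
      ((X - C z₀) ^ d * c + C ε * f).IsRoot (z₀ + z) →
      ¬ (derivative ((X - C z₀) ^ d * c + C ε * f)).IsRoot (z₀ + z) := by
    filter_upwards [eventually_eventually_nhds.2 hfac, hu.eventually_analyticAt,
      hψ.eventually_analyticAt, hu.continuousAt.eventually_ne hu0,
      hψ.deriv.continuousAt.eventually_ne hψ'] with z h1 h2 h3 h4 h5 ε hε hroot hder
    set p := (X - C z₀) ^ d * c + C ε * f
    have e1 : HasDerivAt (fun x => p.eval (z₀ + x)) ((derivative p).eval (z₀ + z)) z := by
      simpa using (p.hasDerivAt (z₀ + z)).comp_const_add z₀ z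
    have e2 := h2.differentiableAt.hasDerivAt.mul
      ((h3.differentiableAt.hasDerivAt.pow d).sub_const ε)
    -- The factorization is differentiated. At a root only `u * d * ψ ^ (d - 1) * ψ'` survives, and
    -- `ψ z ≠ 0` because `ε ≠ 0`.
    have e3 := e1.unique (e2.congr_of_eventuallyEq (h1.mono fun x hx => hx ε))
    have hz := h1.self_of_nhds ε
    rw [IsRoot.def] at hroot hder
    rw [hroot, eq_comm, mul_eq_zero, or_iff_right h4] at hz
    simp only [Pi.pow_apply, hz, hder, mul_zero, zero_add] at e3
    have hψz : ψ z ≠ 0 := by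
      intro h
      rw [h, zero_pow hd, zero_sub, neg_eq_zero] at hz
      exact hε hz
    have hdc : (d : ℂ) ≠ 0 := by exact_mod_cast hd
    exact mul_ne_zero h4 (mul_ne_zero (mul_ne_zero hdc (pow_ne_zero _ hψz)) h5) e3.symm
  have hiff : ∀ᶠ z in 𝓝 (0 : ℂ), ∀ ε : ℂ,
      ((X - C z₀) ^ d * c + C ε * f).IsRoot (z₀ + z) ↔ ψ z ^ d = ε := by
    filter_upwards [hfac, hu.continuousAt.eventually_ne hu0] with z h1 h2 ε
    rw [IsRoot.def, h1, mul_eq_zero, or_iff_right h2, sub_eq_zero]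
  have hΦt : Tendsto Φ (𝓝 0) (𝓝 0) := by
    simpa [hΦ0] using hΦ.continuousAt.tendsto
  have hparam : ∀ᶠ t in 𝓝 (0 : ℂ),
      ((X - C z₀) ^ d * c + C (t ^ d) * f).IsRoot (z₀ + Φ t) := by
    filter_upwards [hr, hΦt.eventually hiff] with t h1 h2
    rw [h2, h1]
  have hall := hl.and <| hr.and <| hΦ.eventually_analyticAt.and <| hψ.eventually_analyticAt.and <|
    hiff.and <| hparam.and hsimple
  obtain ⟨r, hr0, hball⟩ := Metric.eventually_nhds_iff.1 hall
  simp only [dist_zero_right] at hball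
  exact ⟨Φ, ψ, r, hr0, hΦ, hΦ0, hψ0, by rw [hΦ'.deriv]; exact inv_ne_zero hψ',
    fun z hz => (hball hz).1, fun z hz => (hball hz).2.1,
    fun z hz => (hball hz).2.2.1.continuousAt, fun z hz => (hball hz).2.2.2.1.continuousAt,
    fun z hz => (hball hz).2.2.2.2.1, fun z hz => (hball hz).2.2.2.2.2.1,
    fun z hz => (hball hz).2.2.2.2.2.2⟩

/-! ### First-order behaviour of a branch -/

open Polynomial

/-- The squared norm is constant along the ray `ζ * t`, `t ≥ 0`, so its one-sided derivative at `0`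
vanishes: the branch starts tangentially to the circle. -/
theorem re_conj_mul_deriv_eq_zero {Φ : ℂ → ℂ} {z₀ ζ a : ℂ} (hΦ : HasDerivAt Φ a 0) (h0 : Φ 0 = 0)
    (h1 : ∀ᶠ t : ℝ in 𝓝[≥] 0, ‖z₀ + Φ (ζ * t)‖ = 1) :
    ((starRingEnd ℂ) z₀ * (a * ζ)).re = 0 := by
  have e1 : HasDerivAt (fun t : ℝ => z₀ + Φ (ζ * t)) (a * ζ) 0 := by
    have e0 : HasDerivAt (fun t : ℂ => ζ * t) ζ ((0 : ℝ) : ℂ) := by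
      simpa using (hasDerivAt_id ((0 : ℝ) : ℂ)).const_mul ζ
    have hΦ' : HasDerivAt Φ a (ζ * ((0 : ℝ) : ℂ)) := by simpa using hΦ
    exact ((HasDerivAt.comp ((0 : ℝ) : ℂ) hΦ' e0).comp_ofReal).const_add z₀
  have e2 := (e1.norm_sq).hasDerivWithinAt (s := Set.Ici 0)
  have e3 : HasDerivWithinAt (fun t : ℝ => ‖z₀ + Φ (ζ * t)‖ ^ 2) 0 (Set.Ici 0) 0 := by
    refine (hasDerivWithinAt_const (0 : ℝ) (Set.Ici 0) (1 : ℝ)).congr_of_eventuallyEq ?_ ?_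
    · filter_upwards [h1] with t ht
      rw [ht, one_pow]
    · rw [h1.self_of_nhdsWithin Set.self_mem_Ici, one_pow]
  have e4 := (uniqueDiffWithinAt_Ici (0 : ℝ)).eq_deriv _ e2 e3
  simp [h0, Complex.inner] at e4 ⊢
  linarith

theorem eq_mul_I_mul_of_re_conj_mul_eq_zero {z₀ a : ℂ} (hz : ‖z₀‖ = 1)
    (h : ((starRingEnd ℂ) z₀ * a).re = 0) :
    a = z₀ * (Complex.I * (((starRingEnd ℂ) z₀ * a).im : ℝ)) := by
  have h1 : (starRingEnd ℂ) z₀ * a = Complex.I * (((starRingEnd ℂ) z₀ * a).im : ℝ) := by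
    apply Complex.ext <;> simp [-Complex.mul_re, -Complex.mul_im, h, Complex.re_mul_ofReal,
      Complex.im_mul_ofReal]
  rw [← h1, ← mul_assoc, Complex.mul_conj']
  simp [hz]

/-- For `d ≥ 3` the root of unity `exp (2πi / d)` has positive imaginary part. -/
theorem le_two_of_im_pow_root {d : ℕ} (h : ∀ ζ : ℂ, ζ ^ d = 1 → ζ.im = 0) : d ≤ 2 := by
  by_contra! hd
  have hd0 : (d : ℂ) ≠ 0 := by
    have : d ≠ 0 := by omega
    exact_mod_cast this
  have h1 := h (Complex.exp ((2 * Real.pi / d : ℝ) * Complex.I)) (by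
    rw [← Complex.exp_nat_mul, ← Complex.exp_two_pi_mul_I]
    congr 1
    push_cast
    field_simp)
  rw [Complex.exp_ofReal_mul_I_im] at h1
  have hd' : (2 : ℝ) < d := by exact_mod_cast hd
  refine (Real.sin_pos_of_pos_of_lt_pi (by positivity) ?_).ne' h1
  rw [div_lt_iff₀ (by positivity)]
  nlinarith [Real.pi_pos]

/-- Both sides agree in value and first derivative at `0`, so the power series of the difference
starts at order two. -/
theorem isBigO_sub_exp {Φ : ℂ → ℂ} {z₀ b : ℂ} (hΦ : AnalyticAt ℂ Φ 0) (h0 : Φ 0 = 0)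
    (h1 : deriv Φ 0 = z₀ * b) :
    (fun z => z₀ + Φ z - z₀ * Complex.exp (b * z)) =O[𝓝 0] fun z => z ^ 2 := by
  have hF : AnalyticAt ℂ (fun z => z₀ + Φ z - z₀ * Complex.exp (b * z)) 0 := by fun_prop
  have hd : HasDerivAt (fun z => z₀ + Φ z - z₀ * Complex.exp (b * z)) 0 0 := by
    have e1 := (hΦ.differentiableAt.hasDerivAt.const_add z₀).sub
      ((((hasDerivAt_id (0 : ℂ)).const_mul b).cexp).const_mul z₀)
    exact e1.congr_deriv (by simp [h1])
  obtain ⟨p, hp⟩ := hF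
  have h2 := hp.isBigO_sub_partialSum_pow 2
  have hp0 : p 0 = 0 := by
    ext
    rw [hp.coeff_zero]
    simp [h0]
  have hp1 : p 1 = 0 := by
    ext
    simpa [hd.deriv] using hp.deriv.symm
  simp only [FormalMultilinearSeries.partialSum, Finset.sum_range_succ, Finset.range_zero,
    Finset.sum_empty, hp0, hp1, zero_add, zero_apply,
    sub_zero, add_zero] at h2
  exact h2.trans (Asymptotics.isBigO_of_le _ fun x => by simp)

/-- An `O(t²)` bound would make the right derivative at `0` vanish, but it is `-(z₀ * b)`. This
separates moving roots from constant ones. -/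
theorem not_isBigO_sub_mul_exp {z₀ : ℂ} (hz : z₀ ≠ 0) {b : ℂ} (hb : b ≠ 0) :
    ¬ (fun t : ℝ => z₀ - z₀ * Complex.exp (b * t)) =O[𝓝[>] (0 : ℝ)] fun t : ℝ => t ^ 2 := by
  intro h
  have e1 : HasDerivAt (fun t : ℝ => z₀ - z₀ * Complex.exp (b * t)) (-(z₀ * b)) 0 := by
    have e0 : HasDerivAt (fun t : ℂ => z₀ - z₀ * Complex.exp (b * t)) (-(z₀ * b))
        ((0 : ℝ) : ℂ) := by
      have := (((((hasDerivAt_id ((0 : ℝ) : ℂ)).const_mul b).cexp).const_mul z₀).const_sub z₀)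
      simpa using this
    exact e0.comp_ofReal
  have e2 : HasDerivWithinAt (fun t : ℝ => z₀ - z₀ * Complex.exp (b * t)) 0 (Set.Ioi 0) 0 := by
    rw [hasDerivWithinAt_iff_isLittleO]
    have h2 : (fun t : ℝ => t ^ 2) =o[𝓝[>] (0 : ℝ)] fun t : ℝ => t := by
      simpa using (Asymptotics.isLittleO_pow_pow (𝕜 := ℝ) one_lt_two).mono nhdsWithin_le_nhds
    simpa using h.trans_isLittleO h2
  have e3 := (uniqueDiffWithinAt_Ioi (0 : ℝ)).eq_deriv _ e1.hasDerivWithinAt e2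
  exact mul_ne_zero hz hb (neg_eq_zero.1 e3)

/-! ### Splitting off the constant roots -/

theorem charPoly_ne_zero (S : G.Scattering) (φ ε : ℝ) : charPoly S φ ε ≠ 0 :=
  (Matrix.charpoly_monic _).ne_zero

/-- `charPoly S φ ε = (X - lam0) ^ m * ((X - lam0) ^ d * c + ε * f)` for `ε ∈ [0, 1/2]`, where
`lam0` is not a root of `c`, and not a root of `f` unless `d = 0`. -/
structure IsReduction (S : G.Scattering) (φ : ℝ) (lam0 : ℂ) (m d : ℕ) (c f : ℂ[X]) : Prop where
  charPoly_eq : ∀ ε ∈ Set.Icc (0 : ℝ) (1 / 2),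
    charPoly S φ ε = (X - C lam0) ^ m * ((X - C lam0) ^ d * c + C (ε : ℂ) * f)
  left : ¬ c.IsRoot lam0
  right : d ≠ 0 → ¬ f.IsRoot lam0

/-- `m` is the smaller of the orders of `lam0` in `C₀` and in `Q`, the coefficient of `ε`. -/
theorem exists_isReduction (S : G.Scattering) (φ : ℝ) (lam0 : ℂ) :
    ∃ m d c f, (charPoly S φ 0).rootMultiplicity lam0 = m + d ∧
      IsReduction S φ lam0 m d c f := by
  obtain ⟨Q, hQ⟩ := exists_charPoly_eq S φ
  obtain ⟨c, hc, hc'⟩ := Polynomial.exists_eq_pow_rootMultiplicity_mul_and_not_dvd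
    (charPoly S φ 0) (charPoly_ne_zero S φ 0) lam0
  rw [dvd_iff_isRoot] at hc'
  set s := (charPoly S φ 0).rootMultiplicity lam0
  -- The divisible case includes `Q = 0`; there `d = 0`, and nothing is known about `f` at `lam0`.
  by_cases hdiv : (X - C lam0) ^ s ∣ Q
  · obtain ⟨f, hf⟩ := hdiv
    refine ⟨s, 0, c, f, rfl, fun ε hε => ?_, hc', fun h => (h rfl).elim⟩
    rw [hQ ε hε, hc, hf]
    ring
  · have hQ0 : Q ≠ 0 := by
      rintro rfl
      exact hdiv (dvd_zero _)
    obtain ⟨f, hf, hf'⟩ := Polynomial.exists_eq_pow_rootMultiplicity_mul_and_not_dvd Q hQ0 lam0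
    rw [dvd_iff_isRoot] at hf'
    set m := Q.rootMultiplicity lam0
    have hms : m < s := by
      by_contra! h
      exact hdiv (hf ▸ (pow_dvd_pow _ h).mul_right f)
    obtain ⟨d, hd⟩ := Nat.exists_eq_add_of_lt hms
    refine ⟨m, d + 1, c, f, hd, fun ε hε => ?_, hc', fun _ => hf'⟩
    rw [hQ ε hε, hc, hf, hd]
    ring

namespace IsReduction

variable {S : G.Scattering} {φ : ℝ} {lam0 : ℂ} {m d : ℕ} {c f : ℂ[X]}

theorem hasConstRoots (h : IsReduction S φ lam0 m d c f) : HasConstRoots S φ lam0 m := by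
  intro ε hε
  rw [Polynomial.le_rootMultiplicity_iff (charPoly_ne_zero S φ ε), h.charPoly_eq ε hε]
  exact dvd_mul_right _ _

theorem reduced_ne_zero (h : IsReduction S φ lam0 m d c f) {ε : ℝ}
    (hε : ε ∈ Set.Icc (0 : ℝ) (1 / 2)) : (X - C lam0) ^ d * c + C (ε : ℂ) * f ≠ 0 := by
  intro h0
  apply charPoly_ne_zero S φ ε
  rw [h.charPoly_eq ε hε, h0, mul_zero]

theorem isRoot_of_reduced (h : IsReduction S φ lam0 m d c f) {ε : ℝ}
    (hε : ε ∈ Set.Icc (0 : ℝ) (1 / 2)) {μ : ℂ}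
    (hμ : ((X - C lam0) ^ d * c + C (ε : ℂ) * f).IsRoot μ) : (charPoly S φ ε).IsRoot μ := by
  rw [h.charPoly_eq ε hε, root_mul]
  exact Or.inr hμ

theorem reduced_isRoot (h : IsReduction S φ lam0 m d c f) {ε : ℝ}
    (hε : ε ∈ Set.Icc (0 : ℝ) (1 / 2)) {μ : ℂ} (hμ : (charPoly S φ ε).IsRoot μ)
    (hne : μ ≠ lam0) : ((X - C lam0) ^ d * c + C (ε : ℂ) * f).IsRoot μ := by
  rw [h.charPoly_eq ε hε, root_mul] at hμ
  refine hμ.resolve_left fun h => hne ?_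
  rw [IsRoot.def, eval_pow, eval_sub, eval_X, eval_C] at h
  exact sub_eq_zero.1 (eq_zero_of_pow_eq_zero h)

/-- For `ε ≠ 0` the second factor takes the nonzero value `ε * f(lam0)` at `lam0`. -/
theorem rootMultiplicity_le (h : IsReduction S φ lam0 m d c f) (hd : d ≠ 0) {ε : ℝ}
    (hε : ε ∈ Set.Icc (0 : ℝ) (1 / 2)) (h0 : ε ≠ 0) :
    (charPoly S φ ε).rootMultiplicity lam0 ≤ m := by
  have hne := charPoly_ne_zero S φ ε
  rw [h.charPoly_eq ε hε] at hne ⊢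
  rw [rootMultiplicity_mul hne, rootMultiplicity_X_sub_C_pow, rootMultiplicity_eq_zero, add_zero]
  rw [IsRoot.def]
  simpa [hd, h0] using h.right hd

theorem rootMultiplicity_le_one (h : IsReduction S φ lam0 m d c f) {Φ ψ : ℂ → ℂ} {r : ℝ}
    (hB : IsRootBranch c f lam0 d Φ ψ r) {ε : ℝ} (hε : ε ∈ Set.Icc (0 : ℝ) (1 / 2)) (h0 : ε ≠ 0)
    {z : ℂ} (hz : ‖z‖ < r) (hz0 : z ≠ 0) :
    (charPoly S φ ε).rootMultiplicity (lam0 + z) ≤ 1 := by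
  have hne := charPoly_ne_zero S φ ε
  rw [h.charPoly_eq ε hε] at hne ⊢
  rw [rootMultiplicity_mul hne, rootMultiplicity_eq_zero (p := (X - C lam0) ^ m), zero_add]
  · by_contra! hlt
    rw [one_lt_rootMultiplicity_iff_isRoot (h.reduced_ne_zero hε)] at hlt
    exact hB.simple z hz ε (by exact_mod_cast h0) hlt.1 hlt.2
  · simp [IsRoot.def, hz0]

end IsReduction

/-! ### Root families and their labels -/

theorem IsRootFamily.isRoot {S : G.Scattering} {φ : ℝ} {lam0 : ℂ} {s : ℕ} {δ : ℝ}
    {Λ : Fin s → ℝ → ℂ} (hΛ : IsRootFamily S φ lam0 s δ Λ) {ε : ℝ} (hε : ε ∈ Set.Ico 0 δ)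
    (k : Fin s) : (charPoly S φ ε).IsRoot (Λ k ε) :=
  isRoot_of_mem_roots (Multiset.mem_of_le (hΛ.roots ε hε)
    (Multiset.mem_map_of_mem _ (Finset.mem_univ k)))

theorem count_map_univ {s : ℕ} (g : Fin s → ℂ) (a : ℂ) :
    (Finset.univ.val.map g).count a = (Finset.univ.filter fun k => g k = a).card := by
  rw [Multiset.count_map]
  simp only [eq_comm (a := a)]
  rfl

theorem IsRootFamily.card_le {S : G.Scattering} {φ : ℝ} {lam0 : ℂ} {s : ℕ} {δ : ℝ}
    {Λ : Fin s → ℝ → ℂ} (hΛ : IsRootFamily S φ lam0 s δ Λ) {ε : ℝ} (hε : ε ∈ Set.Ico 0 δ)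
    (a : ℂ) : (Finset.univ.filter fun k => Λ k ε = a).card ≤
      (charPoly S φ ε).rootMultiplicity a := by
  rw [← count_map_univ (fun k => Λ k ε), ← count_roots]
  exact Multiset.count_le_of_le _ (hΛ.roots ε hε)

theorem IsRootFamily.mem_Icc {S : G.Scattering} {φ : ℝ} {lam0 : ℂ} {s : ℕ} {δ : ℝ}
    {Λ : Fin s → ℝ → ℂ} (hΛ : IsRootFamily S φ lam0 s δ Λ) {ε : ℝ} (hε : ε ∈ Set.Ico 0 δ) :
    ε ∈ Set.Icc (0 : ℝ) (1 / 2) := ⟨hε.1, hε.2.le.trans hΛ.le_half⟩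

theorem IsRootFamily.tendsto {S : G.Scattering} {φ : ℝ} {lam0 : ℂ} {s : ℕ} {δ : ℝ}
    {Λ : Fin s → ℝ → ℂ} (hΛ : IsRootFamily S φ lam0 s δ Λ) (k : Fin s) :
    Tendsto (Λ k) (𝓝[≥] 0) (𝓝 lam0) := by
  have h := hΛ.continuousOn k 0 ⟨le_rfl, hΛ.pos⟩
  rwa [ContinuousWithinAt, hΛ.zero, nhdsWithin_Ico_eq_nhdsGE hΛ.pos] at h

/-- `τ` is the nonnegative `d`-th root on the half line. -/
structure IsPosRoot (d : ℕ) (τ : ℝ → ℝ) : Prop where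
  continuous : Continuous τ
  pow_eq : ∀ ε, 0 ≤ ε → τ ε ^ d = ε
  pos : ∀ ε, 0 < ε → 0 < τ ε
  zero : τ 0 = 0

theorem isPosRoot_one : IsPosRoot 1 fun ε => ε :=
  ⟨continuous_id, fun _ _ => pow_one _, fun _ h => h, rfl⟩

theorem isPosRoot_two : IsPosRoot 2 fun ε => √ε :=
  ⟨Real.continuous_sqrt, fun _ h => Real.sq_sqrt h, fun _ h => Real.sqrt_pos.2 h, Real.sqrt_zero⟩

/-- Labels of the members of a root family: `0` for the constant roots, at most `m` times, and each
`d`-th root of unity at most once. -/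
structure IsLabelling (m d : ℕ) {s : ℕ} (θ : Fin s → ℂ) : Prop where
  eq_zero_or : ∀ k, θ k = 0 ∨ θ k ^ d = 1
  card_zero_le : (Finset.univ.filter fun k => θ k = 0).card ≤ m
  card_le : ∀ ζ ≠ 0, (Finset.univ.filter fun k => θ k = ζ).card ≤ 1

theorem IsLabelling.norm_le {m d s : ℕ} {θ : Fin s → ℂ} (hθ : IsLabelling m d θ) (hd : d ≠ 0)
    (k : Fin s) : ‖θ k‖ ≤ 1 := by
  rcases hθ.eq_zero_or k with h | h
  · simp [h]
  · exact (Complex.norm_eq_one_of_pow_eq_one h hd).le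

section Labels

variable {S : G.Scattering} {φ : ℝ} {lam0 : ℂ} {m d s : ℕ} {c f : ℂ[X]} {Φ ψ : ℂ → ℂ} {r : ℝ}
  {τ : ℝ → ℝ}

/-- The quotient `ψ (Λ k ε - lam0) / τ ε` is continuous on an interval `(0, η)` and takes values in
the finite set of `0` and the `d`-th roots of unity, so it is constant; this constant is the label.
-/
theorem IsRootFamily.exists_label {δ : ℝ} {Λ : Fin s → ℝ → ℂ}
    (hΛ : IsRootFamily S φ lam0 s δ Λ) (hR : IsReduction S φ lam0 m d c f) (hd : d ≠ 0)
    (hB : IsRootBranch c f lam0 d Φ ψ r) (hτ : IsPosRoot d τ) :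
    ∃ θ : Fin s → ℂ, IsLabelling m d θ ∧
      ∀ k, ∀ᶠ ε in 𝓝[≥] (0 : ℝ), Λ k ε = lam0 + Φ (θ k * τ ε) := by
  have hev : ∀ᶠ ε in 𝓝[≥] (0 : ℝ), ε < δ ∧ ∀ k, ‖Λ k ε - lam0‖ < r := by
    refine (Filter.Eventually.filter_mono nhdsWithin_le_nhds (eventually_lt_nhds hΛ.pos)).and
      (eventually_all.2 fun k => ?_)
    have h := ((hΛ.tendsto k).sub_const lam0).norm
    rw [sub_self, norm_zero] at h
    exact h.eventually_lt_const hB.pos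
  obtain ⟨η, hη0, hη⟩ := mem_nhdsGE_iff_exists_Ico_subset.1 hev
  have hη0 : 0 < η := hη0
  have hmem : ∀ ε ∈ Set.Ioo 0 η, ε ∈ Set.Ico 0 δ := fun ε hε =>
    ⟨hε.1.le, (hη ⟨hε.1.le, hε.2⟩).1⟩
  have hsmall : ∀ ε ∈ Set.Ioo 0 η, ∀ k, ‖Λ k ε - lam0‖ < r := fun ε hε =>
    (hη ⟨hε.1.le, hε.2⟩).2
  have hτC : ∀ ε, 0 < ε → (τ ε : ℂ) ≠ 0 := fun ε hε => by exact_mod_cast (hτ.pos ε hε).ne'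
  let g : Fin s → ℝ → ℂ := fun k ε => ψ (Λ k ε - lam0) / τ ε
  have hgT : ∀ k, Set.MapsTo (g k) (Set.Ioo 0 η) {θ : ℂ | θ = 0 ∨ θ ^ d = 1} := by
    intro k ε hε
    by_cases hz : Λ k ε = lam0
    · exact Or.inl (by simp [g, hz, hB.inv_zero])
    · refine Or.inr ?_
      have h1 := hR.reduced_isRoot (hΛ.mem_Icc (hmem ε hε)) (hΛ.isRoot (hmem ε hε) k) hz
      have h2 := (hB.isRoot_iff _ (hsmall ε hε k) ε).1 (by rwa [add_sub_cancel])
      simp only [g]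
      rw [div_pow, h2, ← Complex.ofReal_pow, hτ.pow_eq ε hε.1.le,
        div_self (by exact_mod_cast hε.1.ne')]
  have hTfin : {θ : ℂ | θ = 0 ∨ θ ^ d = 1}.Finite := by
    refine ((Polynomial.nthRootsFinset d (1 : ℂ)).finite_toSet.insert 0).subset ?_
    rintro θ (h | h)
    · exact Or.inl h
    · exact Or.inr (by simpa [Polynomial.mem_nthRootsFinset (Nat.pos_of_ne_zero hd)] using h)
  have hgc : ∀ k, ContinuousOn (g k) (Set.Ioo 0 η) := by
    intro k ε hε
    refine ContinuousWithinAt.div ?_ ?_ (hτC ε hε.1)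
    · have h1 : ContinuousWithinAt (fun ε => Λ k ε - lam0) (Set.Ioo 0 η) ε :=
        ((hΛ.continuousOn k ε (hmem ε hε)).mono hmem).sub continuousWithinAt_const
      exact ContinuousAt.comp_continuousWithinAt (f := fun ε => Λ k ε - lam0)
        (hB.continuousAt_inv _ (hsmall ε hε k)) h1
    · exact (Complex.continuous_ofReal.comp hτ.continuous).continuousWithinAt
  -- Labels do not depend on `ε`, so the multiplicities at a single sample point bound how often
  -- each one occurs.
  have hhalf : η / 2 ∈ Set.Ioo 0 η := ⟨by linarith, by linarith⟩
  have hval : ∀ k, ∀ ε ∈ Set.Ioo 0 η, Λ k ε = lam0 + Φ (g k (η / 2) * τ ε) := by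
    intro k ε hε
    have h1 : g k ε = g k (η / 2) :=
      isPreconnected_Ioo.constant_of_mapsTo hTfin.isDiscrete (hgc k) (hgT k) hε hhalf
    rw [← h1]
    simp only [g]
    rw [div_mul_cancel₀ _ (hτC ε hε.1), hB.left_inv _ (hsmall ε hε k), add_sub_cancel]
  have hcard : ∀ ζ, (Finset.univ.filter fun k => g k (η / 2) = ζ).card ≤
      (charPoly S φ (η / 2)).rootMultiplicity (lam0 + Φ (ζ * τ (η / 2))) := by
    intro ζ
    refine le_trans (Finset.card_le_card fun k hk => ?_) (hΛ.card_le (hmem _ hhalf) _)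
    simp only [Finset.mem_filter, Finset.mem_univ, true_and] at hk ⊢
    rw [hval k _ hhalf, hk]
  refine ⟨fun k => g k (η / 2), ⟨fun k => hgT k hhalf, ?_, fun ζ hζ => ?_⟩, fun k => ?_⟩
  · refine (hcard 0).trans ?_
    rw [zero_mul, hB.map_zero, add_zero]
    exact hR.rootMultiplicity_le hd (hΛ.mem_Icc (hmem _ hhalf)) hhalf.1.ne'
  · rcases (Finset.univ.filter fun k => g k (η / 2) = ζ).eq_empty_or_nonempty with h | ⟨k, hk⟩
    · simp [h]
    · refine (hcard ζ).trans ?_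
      have hk' : g k (η / 2) = ζ := by simpa using hk
      have h1 := hval k _ hhalf
      rw [hk'] at h1
      have h2 : Φ (ζ * τ (η / 2)) = Λ k (η / 2) - lam0 := by rw [h1]; ring
      refine hR.rootMultiplicity_le_one hB (hΛ.mem_Icc (hmem _ hhalf)) hhalf.1.ne' ?_ ?_
      · rw [h2]
        exact hsmall _ hhalf k
      · rw [h2]
        intro h3
        apply hζ
        rw [← hk']
        simp [g, h3, hB.inv_zero]
  · filter_upwards [Ico_mem_nhdsGE hη0] with ε hε
    rcases hε.1.eq_or_lt with h | h
    · rw [← h, hΛ.zero, hτ.zero]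
      simp [hB.map_zero]
    · exact hval k ε ⟨h, hε.2⟩

/-- For `ε > 0` the left inverse `ψ` of `Φ` shows that different labels give different roots, so the
multiplicity condition reduces to the bounds in `IsLabelling`. -/
theorem IsLabelling.exists_isRootFamily {θ : Fin s → ℂ} (hθ : IsLabelling m d θ)
    (hs : (charPoly S φ 0).rootMultiplicity lam0 = s)
    (hR : IsReduction S φ lam0 m d c f) (hd : d ≠ 0)
    (hB : IsRootBranch c f lam0 d Φ ψ r) (hτ : IsPosRoot d τ) :
    ∃ (δ : ℝ) (Λ : Fin s → ℝ → ℂ), IsRootFamily S φ lam0 s δ Λ := by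
  have hev : ∀ᶠ ε in 𝓝[≥] (0 : ℝ), |τ ε| < r := by
    have h := hτ.continuous.continuousAt (x := 0) |>.tendsto.abs
    rw [hτ.zero, abs_zero] at h
    exact (h.eventually_lt_const hB.pos).filter_mono nhdsWithin_le_nhds
  obtain ⟨η, hη0, hη⟩ := mem_nhdsGE_iff_exists_Ico_subset.1 hev
  have hη0 : 0 < η := hη0
  have hsmall : ∀ k, ∀ ε ∈ Set.Ico 0 (min η (1 / 2)), ‖θ k * τ ε‖ < r := by
    intro k ε hε
    have h1 : |τ ε| < r := hη ⟨hε.1, hε.2.trans_le (min_le_left _ _)⟩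
    rw [norm_mul, Complex.norm_real, Real.norm_eq_abs]
    exact (mul_le_of_le_one_left (abs_nonneg _) (hθ.norm_le hd k)).trans_lt h1
  refine ⟨min η (1 / 2), fun k ε => lam0 + Φ (θ k * τ ε), lt_min hη0 (by norm_num),
    min_le_right _ _, fun k => by simp [hτ.zero, hB.map_zero], fun k ε hε => ?_, fun ε hε => ?_⟩
  · refine continuousWithinAt_const.add ?_
    refine ContinuousAt.comp_continuousWithinAt (hB.continuousAt _ (hsmall k ε hε)) ?_
    exact (continuous_const.mul
      (Complex.continuous_ofReal.comp hτ.continuous)).continuousWithinAt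
  · have hI : ε ∈ Set.Icc (0 : ℝ) (1 / 2) := ⟨hε.1, hε.2.le.trans (min_le_right _ _)⟩
    rw [Multiset.le_iff_count]
    intro a
    rw [count_map_univ, count_roots]
    rcases (Finset.univ.filter fun k => lam0 + Φ (θ k * τ ε) = a).eq_empty_or_nonempty
      with h | ⟨k, hk⟩
    · simp [h]
    have hk : lam0 + Φ (θ k * τ ε) = a := by simpa using hk
    -- At `ε = 0` all labels give `lam0`, whose multiplicity there is the full `s`.
    rcases hε.1.eq_or_lt with h0 | h0
    · rw [← hk, ← h0, hτ.zero]
      simp only [Complex.ofReal_zero, mul_zero, hB.map_zero, add_zero, hs]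
      exact (Finset.card_le_univ _).trans (Fintype.card_fin s).le
    · have hsub : (Finset.univ.filter fun k => lam0 + Φ (θ k * τ ε) = a) ⊆
          Finset.univ.filter fun l => θ l = θ k := by
        intro l hl
        simp only [Finset.mem_filter, Finset.mem_univ, true_and] at hl ⊢
        have h1 : Φ (θ l * τ ε) = Φ (θ k * τ ε) := add_left_cancel (hl.trans hk.symm)
        have h2 := congrArg ψ h1
        rw [hB.right_inv _ (hsmall l ε hε), hB.right_inv _ (hsmall k ε hε)] at h2
        exact mul_right_cancel₀ (by exact_mod_cast (hτ.pos ε h0).ne') h2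
      refine (Finset.card_le_card hsub).trans ?_
      by_cases hk0 : θ k = 0
      · rw [hk0]
        refine hθ.card_zero_le.trans ?_
        rw [← hk, hk0, zero_mul, hB.map_zero, add_zero]
        exact hR.hasConstRoots ε hI
      · refine (hθ.card_le _ hk0).trans ?_
        rw [Nat.one_le_iff_ne_zero, ← Nat.pos_iff_ne_zero,
          rootMultiplicity_pos (charPoly_ne_zero S φ ε)]
        refine hR.isRoot_of_reduced hI ?_
        have h1 := hB.isRoot_param _ (hsmall k ε hε)
        rw [mul_pow, (hθ.eq_zero_or k).resolve_left hk0, one_mul, ← Complex.ofReal_pow,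
          hτ.pow_eq ε hε.1, hk] at h1
        exact h1

/-- The roots on a branch are unimodular, so the branch leaves `lam0` along the unit circle in every
direction given by a root of unity. -/
theorem IsReduction.re_conj_mul_deriv_eq_zero (hR : IsReduction S φ lam0 m d c f) (hd : d ≠ 0)
    (hB : IsRootBranch c f lam0 d Φ ψ r) {ζ : ℂ} (hζ : ζ ^ d = 1) :
    ((starRingEnd ℂ) lam0 * (deriv Φ 0 * ζ)).re = 0 := by
  refine StarWalk.re_conj_mul_deriv_eq_zero hB.analyticAt.differentiableAt.hasDerivAt
    hB.map_zero ?_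
  have h1 : Tendsto (fun t : ℝ => ‖ζ * t‖) (𝓝[≥] 0) (𝓝 0) := by
    have : Continuous fun t : ℝ => ‖ζ * t‖ := by fun_prop
    simpa using (this.tendsto 0).mono_left (nhdsWithin_le_nhds (s := Set.Ici 0))
  have h2 : Tendsto (fun t : ℝ => t ^ d) (𝓝[≥] 0) (𝓝 0) := by
    have : Continuous fun t : ℝ => t ^ d := by fun_prop
    simpa [hd] using (this.tendsto 0).mono_left (nhdsWithin_le_nhds (s := Set.Ici 0))
  filter_upwards [h1.eventually_lt_const hB.pos,
    h2.eventually_lt_const (show (0 : ℝ) < 1 / 2 by norm_num), self_mem_nhdsWithin] with t h3 h4 h5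
  have hI : t ^ d ∈ Set.Icc (0 : ℝ) (1 / 2) := ⟨pow_nonneg h5 d, h4.le⟩
  refine norm_eq_one_of_isRoot_charPoly S φ hI (hR.isRoot_of_reduced hI ?_)
  have h6 := hB.isRoot_param _ h3
  rwa [mul_pow, hζ, one_mul, ← Complex.ofReal_pow] at h6

theorem IsReduction.exists_deriv_eq (hR : IsReduction S φ lam0 m d c f) (hd : d ≠ 0)
    (hB : IsRootBranch c f lam0 d Φ ψ r) (hlam : ‖lam0‖ = 1) :
    ∃ b : ℝ, b ≠ 0 ∧ deriv Φ 0 = lam0 * (Complex.I * b) := by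
  have h1 := hR.re_conj_mul_deriv_eq_zero hd hB (ζ := 1) (one_pow d)
  rw [mul_one] at h1
  have h2 := eq_mul_I_mul_of_re_conj_mul_eq_zero hlam h1
  refine ⟨_, fun h => hB.deriv_ne_zero ?_, h2⟩
  rw [h2, h]
  simp

/-- Since `deriv Φ 0 = lam0 * (I * b)` with `b ≠ 0` real, tangency in direction `ζ` says that `ζ` is
real. -/
theorem IsReduction.le_two (hR : IsReduction S φ lam0 m d c f) (hd : d ≠ 0)
    (hB : IsRootBranch c f lam0 d Φ ψ r) (hlam : ‖lam0‖ = 1) : d ≤ 2 := by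
  obtain ⟨b, hb, hb'⟩ := hR.exists_deriv_eq hd hB hlam
  refine le_two_of_im_pow_root fun ζ hζ => ?_
  have h1 := hR.re_conj_mul_deriv_eq_zero hd hB hζ
  have h2 : (starRingEnd ℂ) lam0 * (deriv Φ 0 * ζ) = Complex.I * b * ζ := by
    have h3 : (starRingEnd ℂ) lam0 * lam0 = 1 := by
      rw [Complex.conj_mul', hlam]
      simp
    rw [hb']
    linear_combination (Complex.I * b * ζ) * h3
  rw [h2] at h1
  simpa [hb] using h1

end Labels

/-! ### Mutual exclusion of the cases -/

theorem not_isConst_of_isBigO_sq {lam0 : ℂ} (hlam : lam0 ≠ 0) {b : ℂ} (hb : b ≠ 0) {g : ℝ → ℂ}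
    (h : (fun ε : ℝ => g ε - lam0 * Complex.exp (b * ε)) =O[𝓝[≥] (0 : ℝ)] fun ε : ℝ => ε ^ 2) :
    ¬ IsConst lam0 g := by
  intro hg
  have h1 : (fun ε : ℝ => lam0 - lam0 * Complex.exp (b * ε)) =O[𝓝[≥] (0 : ℝ)]
      fun ε : ℝ => ε ^ 2 :=
    h.congr' (hg.mono fun ε hε => by simp only [hε]) EventuallyEq.rfl
  exact not_isBigO_sub_mul_exp hlam hb (h1.mono (nhdsWithin_mono _ Set.Ioi_subset_Ici_self))

theorem not_isConst_of_isBigO_sqrt {lam0 : ℂ} (hlam : lam0 ≠ 0) {b : ℂ} (hb : b ≠ 0) {g : ℝ → ℂ}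
    (h : (fun ε : ℝ => g ε - lam0 * Complex.exp (b * (√ε : ℝ))) =O[𝓝[≥] (0 : ℝ)]
      fun ε : ℝ => ε) :
    ¬ IsConst lam0 g := by
  intro hg
  have h1 : (fun ε : ℝ => lam0 - lam0 * Complex.exp (b * (√ε : ℝ))) =O[𝓝[≥] (0 : ℝ)]
      fun ε : ℝ => ε :=
    h.congr' (hg.mono fun ε hε => by simp only [hε]) EventuallyEq.rfl
  -- The substitution `ε = t ^ 2` turns the `√ε` expansion into one in `t`.
  have h2 : Tendsto (fun t : ℝ => t ^ 2) (𝓝[>] 0) (𝓝[≥] 0) := by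
    refine tendsto_nhdsWithin_of_tendsto_nhds_of_eventually_within _ ?_
      (Eventually.of_forall fun t => sq_nonneg t)
    have : Continuous fun t : ℝ => t ^ 2 := by fun_prop
    simpa using (this.tendsto 0).mono_left (nhdsWithin_le_nhds (s := Set.Ioi 0))
  refine not_isBigO_sub_mul_exp hlam hb ((h1.comp_tendsto h2).congr' ?_ EventuallyEq.rfl)
  filter_upwards [self_mem_nhdsWithin] with t ht
  simp [Real.sqrt_sq (le_of_lt ht)]

section Exclusive

variable {S : G.Scattering} {φ : ℝ} {lam0 : ℂ} {s : ℕ} {Λ : Fin s → ℝ → ℂ}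

theorem CaseTwo.exists_unique_not_isConst (hlam : lam0 ≠ 0) (h : CaseTwo S φ lam0 Λ) :
    ∃ p, ¬ IsConst lam0 (Λ p) ∧ ∀ k, k ≠ p → IsConst lam0 (Λ k) := by
  obtain ⟨p, hp, -, b, hb, hO⟩ := h
  refine ⟨p, not_isConst_of_isBigO_sq (b := Complex.I * b) hlam ?_ hO, hp⟩
  simpa using hb

theorem CaseThree.exists_pair_not_isConst (hlam : lam0 ≠ 0) (h : CaseThree S φ lam0 Λ) :
    ∃ p q, p ≠ q ∧ ¬ IsConst lam0 (Λ p) ∧ ¬ IsConst lam0 (Λ q) := by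
  obtain ⟨p, q, hpq, -, -, -, b, hb, hO, hO'⟩ := h
  refine ⟨p, q, hpq, not_isConst_of_isBigO_sqrt (b := Complex.I * b) hlam (by simpa using hb) hO,
    not_isConst_of_isBigO_sqrt (b := -(Complex.I * b)) hlam (by simpa using hb) ?_⟩
  simpa only [neg_mul] using hO'

/-- The number of members that are not eventually constant is zero, exactly one, or at least two,
respectively. -/
theorem exactly_one_case (hlam : lam0 ≠ 0)
    (h : CaseOne S φ lam0 Λ ∨ CaseTwo S φ lam0 Λ ∨ CaseThree S φ lam0 Λ) :
    (CaseOne S φ lam0 Λ ∧ ¬ CaseTwo S φ lam0 Λ ∧ ¬ CaseThree S φ lam0 Λ) ∨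
    (¬ CaseOne S φ lam0 Λ ∧ CaseTwo S φ lam0 Λ ∧ ¬ CaseThree S φ lam0 Λ) ∨
    (¬ CaseOne S φ lam0 Λ ∧ ¬ CaseTwo S φ lam0 Λ ∧ CaseThree S φ lam0 Λ) := by
  have h12 : CaseOne S φ lam0 Λ → ¬ CaseTwo S φ lam0 Λ := fun h1 h2 => by
    obtain ⟨p, hp, -⟩ := h2.exists_unique_not_isConst hlam
    exact hp (h1.1 p)
  have h13 : CaseOne S φ lam0 Λ → ¬ CaseThree S φ lam0 Λ := fun h1 h3 => by
    obtain ⟨p, -, -, hp, -⟩ := h3.exists_pair_not_isConst hlam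
    exact hp (h1.1 p)
  have h23 : CaseTwo S φ lam0 Λ → ¬ CaseThree S φ lam0 Λ := fun h2 h3 => by
    obtain ⟨p, -, hp⟩ := h2.exists_unique_not_isConst hlam
    obtain ⟨q, q', hq, h1, h1'⟩ := h3.exists_pair_not_isConst hlam
    exact hq ((not_imp_comm.1 (hp q) h1).trans (not_imp_comm.1 (hp q') h1').symm)
  tauto

end Exclusive

/-! ### The cases `d = 0, 1, 2` -/

section Cases

variable {S : G.Scattering} {φ : ℝ} {lam0 : ℂ} {m d s : ℕ} {c f : ℂ[X]} {δ : ℝ}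

/-- A value other than `lam0` would be a root of `c + ε * f`, which tends to `c(lam0) ≠ 0` along the
family. -/
theorem IsReduction.caseOne {Λ : Fin m → ℝ → ℂ} (hR : IsReduction S φ lam0 m 0 c f)
    (hΛ : IsRootFamily S φ lam0 m δ Λ) : CaseOne S φ lam0 Λ := by
  refine ⟨fun k => ?_, hR.hasConstRoots⟩
  have h1 : Tendsto (fun ε : ℝ => c.eval (Λ k ε) + ε * f.eval (Λ k ε)) (𝓝[≥] 0)
      (𝓝 (c.eval lam0 + (0 : ℝ) * f.eval lam0)) :=
    ((c.continuous.tendsto _).comp (hΛ.tendsto k)).add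
      (((Complex.continuous_ofReal.tendsto 0).mono_left nhdsWithin_le_nhds).mul
        ((f.continuous.tendsto _).comp (hΛ.tendsto k)))
  have h2 : c.eval lam0 + ((0 : ℝ) : ℂ) * f.eval lam0 ≠ 0 := by
    simpa using hR.left
  filter_upwards [h1.eventually_ne h2, Ico_mem_nhdsGE hΛ.pos] with ε h3 hε
  by_contra hne
  have h4 := hR.reduced_isRoot (hΛ.mem_Icc hε) (hΛ.isRoot hε k) hne
  exact h3 (by simpa using h4)

theorem IsReduction.exists_isRootFamily_const (hR : IsReduction S φ lam0 m 0 c f) :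
    ∃ (δ : ℝ) (Λ : Fin m → ℝ → ℂ), IsRootFamily S φ lam0 m δ Λ := by
  refine ⟨1 / 2, fun _ _ => lam0, by norm_num, le_rfl, fun _ => rfl, fun _ => continuousOn_const,
    fun ε hε => ?_⟩
  have h : (Finset.univ.val.map fun _ : Fin m => lam0) = Multiset.replicate m lam0 := by
    rw [Multiset.map_const']
    simp
  rw [h, ← Multiset.le_count_iff_replicate_le, count_roots]
  exact hR.hasConstRoots ε ⟨hε.1, hε.2.le⟩

variable {Φ ψ : ℂ → ℂ} {r : ℝ}

theorem isLabelling_single : IsLabelling m 1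
    (fun k : Fin (m + 1) => if k = 0 then (1 : ℂ) else 0) where
  eq_zero_or k := by by_cases h : k = 0 <;> simp [h]
  card_zero_le := by
    refine (Finset.card_le_card (t := Finset.univ.erase 0) fun k hk => ?_).trans (by simp)
    simpa using hk
  card_le ζ hζ := by
    rw [Finset.card_le_one]
    have : ∀ k : Fin (m + 1), (if k = 0 then (1 : ℂ) else 0) = ζ → k = 0 := by
      intro k hk
      by_contra h
      rw [if_neg h] at hk
      exact hζ hk.symm
    intro a ha b hb
    rw [this a (by simpa using ha), this b (by simpa using hb)]

theorem isLabelling_pair : IsLabelling m 2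
    (fun k : Fin (m + 2) => if k = 0 then (1 : ℂ) else if k = 1 then -1 else 0) where
  eq_zero_or k := by
    by_cases h : k = 0
    · simp [h]
    · by_cases h' : k = 1 <;> simp [h, h']
  card_zero_le := by
    refine (Finset.card_le_card (t := (Finset.univ.erase 0).erase 1) fun k hk => ?_).trans
      (by simp)
    by_cases h : k = 0
    · simp [h] at hk
    · by_cases h' : k = 1
      · simp [h'] at hk
      · simp [h, h']
  card_le ζ hζ := by
    rw [Finset.card_le_one]
    intro a ha b hb
    have ha : (if a = 0 then (1 : ℂ) else if a = 1 then -1 else 0) = ζ := by simpa using ha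
    have hb : (if b = 0 then (1 : ℂ) else if b = 1 then -1 else 0) = ζ := by simpa using hb
    have h11 : (1 : ℂ) ≠ -1 := by norm_num
    have h11' : (-1 : ℂ) ≠ 1 := by norm_num
    grind

/-- Pigeonhole: the label `0` takes up at most `m` indices and each label in `t` at most one. -/
theorem IsLabelling.exists_eq_of_card_lt {θ : Fin s → ℂ} (hθ : IsLabelling m d θ)
    {t : Finset ℂ} (ht : m + t.card < s) (h0 : (0 : ℂ) ∉ t) : ∃ k, θ k ≠ 0 ∧ θ k ∉ t := by
  by_contra! h
  have h1 : (Finset.univ : Finset (Fin s)) ⊆ (Finset.univ.filter fun k => θ k = 0) ∪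
      t.biUnion fun ζ => Finset.univ.filter fun k => θ k = ζ := by
    intro k _
    by_cases hk : θ k = 0
    · simp [hk]
    · simp [hk, h k hk]
  have h2 := (Finset.card_le_card h1).trans (Finset.card_union_le _ _)
  have h3 : (t.biUnion fun ζ => Finset.univ.filter fun k => θ k = ζ).card ≤ t.card * 1 :=
    Finset.card_biUnion_le_card_mul _ _ _ fun ζ hζ =>
      hθ.card_le ζ fun hz => h0 (hz ▸ hζ)
  rw [Finset.card_univ, Fintype.card_fin] at h2
  have h4 := hθ.card_zero_le
  omega

theorem IsLabelling.eq_of_eq {θ : Fin s → ℂ} (hθ : IsLabelling m d θ) {k l : Fin s}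
    (hk : θ k ≠ 0) (h : θ l = θ k) : l = k :=
  Finset.card_le_one.1 (hθ.card_le _ hk) l (by simpa using h) k (by simp)

theorem isConst_of_label_eq_zero {τ : ℝ → ℝ} (hB : IsRootBranch c f lam0 d Φ ψ r) {g : ℝ → ℂ}
    {ζ : ℂ} (hg : ∀ᶠ ε in 𝓝[≥] (0 : ℝ), g ε = lam0 + Φ (ζ * τ ε)) (hζ : ζ = 0) :
    IsConst lam0 g := by
  filter_upwards [hg] with ε hε
  rw [hε, hζ, zero_mul, hB.map_zero, add_zero]

theorem IsReduction.caseTwo {Λ : Fin (m + 1) → ℝ → ℂ} (hR : IsReduction S φ lam0 m 1 c f)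
    (hB : IsRootBranch c f lam0 1 Φ ψ r) (hlam : ‖lam0‖ = 1)
    (hΛ : IsRootFamily S φ lam0 (m + 1) δ Λ) : CaseTwo S φ lam0 Λ := by
  obtain ⟨θ, hθ, hval⟩ := hΛ.exists_label hR one_ne_zero hB isPosRoot_one
  obtain ⟨p, hp0, -⟩ := hθ.exists_eq_of_card_lt (t := ∅) (by simp) (by simp)
  have hone : ∀ k, θ k ≠ 0 → θ k = 1 := fun k hk => by
    simpa using (hθ.eq_zero_or k).resolve_left hk
  obtain ⟨b, hb, hb'⟩ := hR.exists_deriv_eq one_ne_zero hB hlam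
  refine ⟨p, fun k hk => isConst_of_label_eq_zero hB (hval k) ?_, hR.hasConstRoots, b, hb, ?_⟩
  · by_contra h
    exact hk (hθ.eq_of_eq hp0 ((hone k h).trans (hone p hp0).symm))
  · have h1 : Tendsto (fun ε : ℝ => (ε : ℂ)) (𝓝[≥] 0) (𝓝 0) :=
      (Complex.continuous_ofReal.tendsto' 0 0 rfl).mono_left nhdsWithin_le_nhds
    have h2 := (isBigO_sub_exp hB.analyticAt hB.map_zero hb').comp_tendsto h1
    refine (h2.congr' ?_ EventuallyEq.rfl).trans (Asymptotics.isBigO_of_le _ fun ε => by simp)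
    filter_upwards [hval p] with ε hε
    simp [hε, hone p hp0]

theorem IsReduction.caseThree {Λ : Fin (m + 2) → ℝ → ℂ} (hR : IsReduction S φ lam0 m 2 c f)
    (hB : IsRootBranch c f lam0 2 Φ ψ r) (hlam : ‖lam0‖ = 1)
    (hΛ : IsRootFamily S φ lam0 (m + 2) δ Λ) : CaseThree S φ lam0 Λ := by
  obtain ⟨θ, hθ, hval⟩ := hΛ.exists_label hR two_ne_zero hB isPosRoot_two
  have htwo : ∀ k, θ k = 0 ∨ θ k = 1 ∨ θ k = -1 := fun k => by
    simpa using hθ.eq_zero_or k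
  -- Excluding `0` and `-1` accounts for at most `m + 1` of the `m + 2` indices, so some label is
  -- `1`; symmetrically for `-1`.
  obtain ⟨p, hp0, hp⟩ := hθ.exists_eq_of_card_lt (t := {-1}) (by simp) (by simp)
  obtain ⟨q, hq0, hq⟩ := hθ.exists_eq_of_card_lt (t := {1}) (by simp) (by simp)
  have hp1 : θ p = 1 := by
    have := htwo p
    simp only [Finset.mem_singleton] at hp
    tauto
  have hq1 : θ q = -1 := by
    have := htwo q
    simp only [Finset.mem_singleton] at hq
    tauto
  obtain ⟨b, hb, hb'⟩ := hR.exists_deriv_eq two_ne_zero hB hlam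
  have h1 : Tendsto (fun ε : ℝ => ((√ε : ℝ) : ℂ)) (𝓝[≥] 0) (𝓝 0) :=
    ((Complex.continuous_ofReal.comp Real.continuous_sqrt).tendsto' 0 0 (by simp)).mono_left
      nhdsWithin_le_nhds
  have h2 := isBigO_sub_exp hB.analyticAt hB.map_zero hb'
  -- The labels `1` and `-1` evaluate the same analytic function `lam0 + Φ` at `√ε` and `-√ε`, which
  -- is the pairing.
  refine ⟨p, q, ?_, fun k hkp hkq => isConst_of_label_eq_zero hB (hval k) ?_, hR.hasConstRoots,
    ⟨fun z => lam0 + Φ z, analyticAt_const.add hB.analyticAt, ?_⟩, b, hb, ?_, ?_⟩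
  · rintro rfl
    rw [hp1] at hq1
    norm_num at hq1
  · rcases htwo k with h | h | h
    · exact h
    · exact (hkp (hθ.eq_of_eq hp0 (h.trans hp1.symm))).elim
    · exact (hkq (hθ.eq_of_eq hq0 (h.trans hq1.symm))).elim
  · filter_upwards [hval p, hval q] with ε h3 h4
    rw [h3, h4, hp1, hq1]
    simp
  · refine ((h2.comp_tendsto h1).congr' ?_ EventuallyEq.rfl).trans
      (Asymptotics.IsBigO.of_bound 1 ?_)
    · filter_upwards [hval p] with ε hε
      simp [hε, hp1]
    · filter_upwards [self_mem_nhdsWithin] with ε hε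
      have hε : (0 : ℝ) ≤ ε := hε
      simp [Real.sq_sqrt hε, abs_of_nonneg (Real.sqrt_nonneg ε), abs_of_nonneg hε]
  · have h1' : Tendsto (fun ε : ℝ => -((√ε : ℝ) : ℂ)) (𝓝[≥] 0) (𝓝 0) := by
      simpa using h1.neg
    refine ((h2.comp_tendsto h1').congr' ?_ EventuallyEq.rfl).trans
      (Asymptotics.IsBigO.of_bound 1 ?_)
    · filter_upwards [hval q] with ε hε
      simp [hε, hq1]
    · filter_upwards [self_mem_nhdsWithin] with ε hε
      have hε : (0 : ℝ) ≤ ε := hε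
      simp [Real.sq_sqrt hε, abs_of_nonneg (Real.sqrt_nonneg ε), abs_of_nonneg hε]

end Cases

end StarWalk

end

theorem theorem2 {V E : Type*} [Fintype E] [DecidableEq E] [DecidableEq V]
    (G : StarWalk.RootedGraph V E) (S : G.Scattering) (φ : ℝ) (lam0 : ℂ) (s : ℕ) (hs : 0 < s)
    (hmult : (StarWalk.charPoly S φ 0).rootMultiplicity lam0 = s) :
    (∃ (δ : ℝ) (Λ : Fin s → ℝ → ℂ), StarWalk.IsRootFamily S φ lam0 s δ Λ) ∧
    ∀ (δ : ℝ) (Λ : Fin s → ℝ → ℂ), StarWalk.IsRootFamily S φ lam0 s δ Λ →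
      (StarWalk.CaseOne S φ lam0 Λ ∧ ¬ StarWalk.CaseTwo S φ lam0 Λ ∧
          ¬ StarWalk.CaseThree S φ lam0 Λ) ∨
      (¬ StarWalk.CaseOne S φ lam0 Λ ∧ StarWalk.CaseTwo S φ lam0 Λ ∧
          ¬ StarWalk.CaseThree S φ lam0 Λ) ∨
      (¬ StarWalk.CaseOne S φ lam0 Λ ∧ ¬ StarWalk.CaseTwo S φ lam0 Λ ∧
          StarWalk.CaseThree S φ lam0 Λ) := by
  open StarWalk in
  have hlam : ‖lam0‖ = 1 := by
    refine norm_eq_one_of_isRoot_charPoly S φ (ε := 0) ⟨le_rfl, by norm_num⟩ ?_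
    rwa [← Polynomial.rootMultiplicity_pos (charPoly_ne_zero S φ 0), hmult]
  have hlam0 : lam0 ≠ 0 := by
    rintro rfl
    simp at hlam
  obtain ⟨m, d, c, f, hmd, hR⟩ := StarWalk.exists_isReduction S φ lam0
  obtain rfl := hmult.symm.trans hmd
  rcases Nat.eq_zero_or_pos d with rfl | hd
  · exact ⟨hR.exists_isRootFamily_const, fun δ Λ hΛ =>
      StarWalk.exactly_one_case hlam0 (Or.inl (hR.caseOne hΛ))⟩
  · obtain ⟨Φ, ψ, r, hB⟩ := StarWalk.exists_isRootBranch hR.left (hR.right hd.ne') hd.ne'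
    have hd2 := hR.le_two hd.ne' hB hlam
    interval_cases d
    · exact ⟨StarWalk.isLabelling_single.exists_isRootFamily hmd hR one_ne_zero hB
        StarWalk.isPosRoot_one, fun δ Λ hΛ =>
        StarWalk.exactly_one_case hlam0 (Or.inr (Or.inl (hR.caseTwo hB hlam hΛ)))⟩
    · exact ⟨StarWalk.isLabelling_pair.exists_isRootFamily hmd hR two_ne_zero hB
        StarWalk.isPosRoot_two, fun δ Λ hΛ =>
        StarWalk.exactly_one_case hlam0 (Or.inr (Or.inr (hR.caseThree hB hlam hΛ)))⟩
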